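/- Let $f_1,\dots,f_m:\mathbb{R}^d\to\mathbb{R}$ ($m\ge1$) be twice continuously differentiable and $f=\frac1m\sum_{i=1}^m f_i$. Assume that $f$ is standard self-concordant, i.e. $f$ is convex and $C^3$ with $|u^T(f'''(w)[u])u|\le 2\,(u^Tf''(w)u)^{3/2}$ for all $w,u\in\mathbb{R}^d$, and that $\lambda I\preceq f''(w)\preceq LI$ for all $w$, with constants $0<\lambda\le L$. Let $w_\star$ be the minimizer of $f$, let $\beta=1/20$ and $\omega(t)=t-\log(1+t)$, and let $\lceil t\rceil$ denote the smallest nonnegative integer $\ge t$. Distributed PCG. Given $w$ and $\mu$, put $H=f''(w)$, $P=f_1''(w)+\mu I$ (with $P^{-1}$ read as $0$ if $P$ is singular, which cannot happen when $f_1$ is convex and $\mu>0$), $\varepsilon_w=\beta(\lambda/L)^{1/2}\|f'(w)\|_2$ and $T_\mu=\big\lceil\sqrt{1+2\mu/\lambda}\,\log\frac{2L}{\beta\lambda}\big\rceil$. Start from $v^{(0)}=0$, $r^{(0)}=f'(w)$, $u^{(0)}=s^{(0)}=P^{-1}r^{(0)}$, and for $t=0,1,2,\dots$ set $\alpha_t=\frac{\langle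 r^{(t)},s^{(t)}\rangle}{\langle u^{(t)},Hu^{(t)}\rangle}$, $v^{(t+1)}=v^{(t)}+\alpha_tu^{(t)}$, $r^{(t+1)}=r^{(t)}-\alpha_tHu^{(t)}$, $s^{(t+1)}=P^{-1}r^{(t+1)}$, $u^{(t+1)}=s^{(t+1)}+\frac{\langle r^{(t+1)},s^{(t+1)}\rangle}{\langle r^{(t)},s^{(t)}\rangle}u^{(t)}$, until $\|r^{(t+1)}\|_2\le\varepsilon_w$ or $T_\mu$ iterations have been made (a quotient with denominator $0$ is read as $0$). Return $v=v^{(t+1)}$, $r=r^{(t+1)}$, the tolerance $\varepsilon_w$ and $\delta=\sqrt{v^THv^{(t)}+\alpha_t\,v^THu^{(t)}}$. Such a call costs one communication round for forming $f'(w)$ and one for each iteration. Adaptive DiSCO. Fix $\rho\ge0$ and $\mu_0>0$. Using one communication round, set $w_0=\frac1m\sum_{i=1}^m\widehat w_i$, where $\widehat w_i$ minimizes $f_i(w)+\frac\rho2\|w\|_2^2$ over $\mathbb{R}^d$. For $k=0,1,2,\dots$ call distributed PCG at $w_k$ with parameter $\mu_k$, obtaining $v_k,r_k,\delta_k$ and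 the tolerance $\epsilon_k=\varepsilon_{w_k}$; if $\|r_k\|_2>\epsilon_k$, replace $\mu_k$ by $2\mu_k$ and call again at the same $w_k$; otherwise set $\mu_{k+1}=\mu_k/2$ and $w_{k+1}=w_k-\frac{1}{1+\delta_k}v_k$. Then for every $\epsilon>0$ the method generates, after finitely many PCG calls, an iterate $\widehat w$ with $f(\widehat w)-f(w_\star)<\epsilon$. The total number $T$ of communication rounds used until the first such iterate is obtained satisfies \[ T\le 1+\left(2\left\lceil\frac{f(w_0)-f(w_\star)}{\omega(1/6)}\right\rceil+2\left\lceil\log_2\frac{2\omega(1/6)}{\epsilon}\right\rceil+\log_2\frac{\mu_{\max}}{\mu_0}\right)\left(2+\sqrt{1+\frac{2\mu_{\max}}{\lambda}}\,\log\frac{2L}{\beta\lambda}\right), \] where $\mu_{\max}$ is the largest value taken by the variable $\mu$ up to that moment (including the input value $\mu_0$ and all doubled values). -/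

import Mathlib

open scoped RealInnerProductSpace

noncomputable section

namespace DiSCO

/-- `ℝ^d` with the Euclidean norm. -/
abbrev Vec (d : ℕ) : Type := EuclideanSpace ℝ (Fin d)

/-- The Hessian `g''(w)`, as a linear operator on `ℝ^d`: the derivative of the gradient map. -/
def hess {d : ℕ} (g : Vec d → ℝ) (w : Vec d) : Vec d →L[ℝ] Vec d :=
  fderiv ℝ (gradient g) w

/-- Self-concordance with parameter `M`: a convex `C³` function on `ℝ^d` with
`|uᵀ (g'''(w)[u]) u| ≤ M (uᵀ g''(w) u)^{3/2}`, where
`g'''(w)[u] = lim_{t → 0} (g''(w + t u) - g''(w)) / t`. -/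
structure IsSelfConcordant {d : ℕ} (g : Vec d → ℝ) (M : ℝ) : Prop where
  contDiff : ContDiff ℝ 3 g
  convex : ConvexOn ℝ Set.univ g
  bound : ∀ w u : Vec d,
    |⟪u, (lineDeriv ℝ (hess g) w u) u⟫| ≤ M * ⟪u, hess g w u⟫ ^ (3 / 2 : ℝ)

/-- `g` is `C²`, `0 < lam ≤ L`, and `lam I ⪯ g''(w) ⪯ L I` for all `w`. -/
structure HessianBounds {d : ℕ} (g : Vec d → ℝ) (lam L : ℝ) : Prop where
  contDiff : ContDiff ℝ 2 g
  lam_pos : 0 < lam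
  lam_le : lam ≤ L
  lower : ∀ w u : Vec d, lam * ‖u‖ ^ 2 ≤ ⟪u, hess g w u⟫
  upper : ∀ w u : Vec d, ⟪u, hess g w u⟫ ≤ L * ‖u‖ ^ 2

/-- `ω(t) = t - log (1 + t)`. -/
def omega (t : ℝ) : ℝ := t - Real.log (1 + t)

/-- The accuracy constant `β = 1/20`. -/
def beta : ℝ := 1 / 20

/-- The average of one item per machine, as formed by one aggregation. -/
def average {m : ℕ} {V : Type*} [AddCommGroup V] [Module ℝ V] (x : Fin m → V) : V :=
  (1 / (m : ℝ)) • ∑ i, x i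

/-- The overall objective `(1/m) ∑ᵢ fᵢ`. -/
def objective {m d : ℕ} (f : Fin m → Vec d → ℝ) (w : Vec d) : ℝ :=
  average fun i => f i w

/-! ### The distributed preconditioned conjugate gradient method -/

/-- The vectors `v⁽ᵗ⁾, r⁽ᵗ⁾, s⁽ᵗ⁾, u⁽ᵗ⁾` of the PCG method. -/
structure PCGState (d : ℕ) where
  v : Vec d
  r : Vec d
  s : Vec d
  u : Vec d

/-- Initial PCG state, for the system `H v = g` with preconditioner `P`. -/
def pcgInit {d : ℕ} (P : Vec d →L[ℝ] Vec d) (g : Vec d) : PCGState d where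
  v := 0
  r := g
  s := P.inverse g
  u := P.inverse g

/-- `α_t = ⟨r⁽ᵗ⁾, s⁽ᵗ⁾⟩ / ⟨u⁽ᵗ⁾, H u⁽ᵗ⁾⟩`. -/
def pcgAlpha {d : ℕ} (H : Vec d →L[ℝ] Vec d) (x : PCGState d) : ℝ :=
  ⟪x.r, x.s⟫ / ⟪x.u, H x.u⟫

/-- One PCG iteration. -/
def pcgStep {d : ℕ} (P H : Vec d →L[ℝ] Vec d) (x : PCGState d) : PCGState d :=
  let r' := x.r - pcgAlpha H x • H x.u
  let s' := P.inverse r'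
  { v := x.v + pcgAlpha H x • x.u
    r := r'
    s := s'
    u := s' + (⟪r', s'⟫ / ⟪x.r, x.s⟫) • x.u }

/-- The PCG state after `t` iterations. -/
def pcgIterate {d : ℕ} (P H : Vec d →L[ℝ] Vec d) (g : Vec d) (t : ℕ) : PCGState d :=
  (pcgStep P H)^[t] (pcgInit P g)

/-- Number of iterations performed by "repeat a PCG iteration until `‖r‖ ≤ tol`", when the
loop is in addition stopped after `cap` iterations. -/
def pcgCount {d : ℕ} (P H : Vec d →L[ℝ] Vec d) (g : Vec d) (tol : ℝ) (cap : ℕ) : ℕ :=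
  sInf {t : ℕ | 1 ≤ t ∧ (‖(pcgIterate P H g t).r‖ ≤ tol ∨ cap ≤ t)}

/-- What one call of the PCG method returns, with the number of communication rounds spent. -/
structure PCGOutput (d : ℕ) where
  /-- the approximate Newton step `v_k` -/
  v : Vec d
  /-- the residual `r_k` -/
  r : Vec d
  /-- the approximate Newton decrement `δ_k` -/
  δ : ℝ
  /-- the tolerance `ε_k` -/
  tol : ℝ
  /-- the communication rounds used by the call -/
  rounds : ℕ

/-- The cap `T_μ = ⌈√(1 + 2μ/λ) log (2L/(βλ))⌉` on the number of PCG iterations. -/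
def pcgCap (lam L μ : ℝ) : ℕ :=
  ⌈Real.sqrt (1 + 2 * μ / lam) * Real.log (2 * L / (beta * lam))⌉₊

/-- One call of distributed PCG at the point `w` with parameter `μ`, run for at most `T_μ`
iterations. Machine `0` is the master, with preconditioner `P = f₀''(w) + μ I`; `H` is the
overall Hessian, which enters only through products `H x = (1/m) ∑ᵢ fᵢ''(w) x`. One round is
spent on the gradient, and one on every PCG iteration. -/
def pcgCall {m d : ℕ} [NeZero m] (f : Fin m → Vec d → ℝ) (lam L : ℝ) (w : Vec d) (μ : ℝ) :
    PCGOutput d :=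
  let H : Vec d →L[ℝ] Vec d := average fun i => hess (f i) w
  let P : Vec d →L[ℝ] Vec d := hess (f 0) w + μ • ContinuousLinearMap.id ℝ (Vec d)
  let g : Vec d := average fun i => gradient (f i) w
  let tol : ℝ := beta * (lam / L) ^ (1 / 2 : ℝ) * ‖g‖
  let N : ℕ := pcgCount P H g tol (pcgCap lam L μ)
  let last := pcgIterate P H g (N - 1)
  let out := pcgIterate P H g N
  { v := out.v
    r := out.r
    δ := Real.sqrt (⟪out.v, H last.v⟫ + pcgAlpha H last * ⟪out.v, H last.u⟫)
    tol := tol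
    rounds := 1 + N }

/-! ### Adaptive DiSCO -/

/-- State of adaptive DiSCO between two calls of the PCG method. -/
structure State (d : ℕ) where
  /-- the current iterate `w_k` -/
  w : Vec d
  /-- the current value of the variable `μ_k` -/
  μ : ℝ
  /-- the largest value that this variable has taken so far -/
  μmax : ℝ
  /-- the communication rounds used so far -/
  rounds : ℕ

/-- Initial state: `w₀` is the average of the local solutions `what i`, which takes one round. -/
def init {m d : ℕ} (what : Fin m → Vec d) (μ₀ : ℝ) : State d where
  w := average what
  μ := μ₀
  μmax := μ₀
  rounds := 1

open Classical in
/-- One PCG call of adaptive DiSCO and the reaction to it: if the residual exceeds the tolerance,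
`μ_k` is doubled and `w_k` is kept; otherwise `μ_{k+1} = μ_k / 2` and
`w_{k+1} = w_k - v_k / (1 + δ_k)`. -/
def step {m d : ℕ} [NeZero m] (f : Fin m → Vec d → ℝ) (lam L : ℝ) (S : State d) : State d :=
  let o := pcgCall f lam L S.w S.μ
  if o.tol < ‖o.r‖ then
    { w := S.w
      μ := 2 * S.μ
      μmax := max S.μmax (2 * S.μ)
      rounds := S.rounds + o.rounds }
  else
    { w := S.w - (1 / (1 + o.δ)) • o.v
      μ := S.μ / 2
      μmax := max S.μmax (S.μ / 2)
      rounds := S.rounds + o.rounds }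

/-- The state of adaptive DiSCO after `n` calls of the PCG method. -/
def run {m d : ℕ} [NeZero m] (f : Fin m → Vec d → ℝ) (lam L : ℝ) (what : Fin m → Vec d)
    (μ₀ : ℝ) (n : ℕ) : State d :=
  (step f lam L)^[n] (init what μ₀)

end DiSCO

end

/-! The bound combines a count of Newton steps with a ledger for `μ`.

A successful call returns `v` with `‖f'(w) - H v‖ ≤ β √(λ/L) ‖f'(w)‖`. In the energy norm of `H`,
`v` is then within a factor `β` of the exact Newton step. Self-concordance bounds `f` from both
sides along segments, so the damped step lowers the gap by `ω(1/6)` or at least halves it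
(`HessianBounds.gap_damped_step_le`). Iterating this worst case, `gapStep_iterate_lt` gives a number
`K`, the sum of the two ceilings, of successes that push the gap below `ε`.

A failed call doubles `μ` and a successful one halves it, so after `n` calls with `s` successes `μ =
μ₀ 2^n / 4^s`. Since `μ ≤ μmax`, this gives `n ≤ 2 s + log₂ (μmax / μ₀)`. Each call costs at most `1
+ T_μ` rounds, which is monotone in `μ`; multiplying gives the estimate.

Convergence of PCG is needed only to exclude endless failure. Once `μ ≥ ‖f₁''(w) - f''(w)‖`, one has
`H ≼ P ≼ (1 + 2μ/λ) H`, and the optimality of conjugate gradients over Krylov spaces, tested with a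
Chebyshev polynomial, gives the tolerance within `T_μ` iterations (`norm_pcgIterate_r_le`). -/

open scoped RealInnerProductSpace

noncomputable section

namespace DiSCO

/-! ### Chebyshev polynomials of operators self-adjoint in an energy form -/

section OperatorBounds

variable {E : Type*} [NormedAddCommGroup E] [InnerProductSpace ℝ E]

theorem inner_aeval_comm (H B : E →L[ℝ] E) (hB : ∀ x y, ⟪B x, H y⟫ = ⟪x, H (B y)⟫)
    (p : Polynomial ℝ) (x y : E) :
    ⟪Polynomial.aeval B p x, H y⟫ = ⟪x, H (Polynomial.aeval B p y)⟫ := by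
  induction p using Polynomial.induction_on' generalizing x y with
  | add p q hp hq => simp [inner_add_left, inner_add_right, hp, hq]
  | monomial n a =>
    have key : ∀ (n : ℕ) (x y : E), ⟪(B ^ n) x, H y⟫ = ⟪x, H ((B ^ n) y)⟫ := by
      intro n
      induction n with
      | zero => simp
      | succ n ih =>
        intro x y
        rw [pow_succ, mul_apply_eq_comp, ih, hB,
          ← mul_apply_eq_comp B, ← pow_succ', pow_succ]
    simp only [Polynomial.aeval_monomial, Algebra.algebraMap_eq_smul_one, smul_mul_assoc, one_mul,
      smul_apply, map_smul, inner_smul_left, inner_smul_right, key,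
      RCLike.conj_to_real]

theorem chebyshev_T_sq_add (n : ℤ) :
    Polynomial.Chebyshev.T ℝ (n + 1) ^ 2
      + (1 - Polynomial.X ^ 2) * Polynomial.Chebyshev.U ℝ n ^ 2 = 1 := by
  have h1 := congrArg (fun p => Polynomial.comp p (2 * Polynomial.X))
    (Polynomial.Chebyshev.S_sq_add_S_sq ℝ n)
  simp only [Polynomial.add_comp, Polynomial.sub_comp, Polynomial.mul_comp, Polynomial.pow_comp,
    Polynomial.Chebyshev.S_comp_two_mul_X, Polynomial.X_comp, Polynomial.one_comp] at h1
  have h2 := Polynomial.Chebyshev.T_eq_U_sub_X_mul_U ℝ (n + 1)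
  rw [add_sub_cancel_right] at h2
  rw [h2]
  linear_combination h1

/-- A contraction in the form of `H` satisfies `B² ≤ 1` in that form. -/
theorem inner_sub_sq_nonneg (H B : E →L[ℝ] E) (hB : ∀ x y, ⟪B x, H y⟫ = ⟪x, H (B y)⟫)
    (h1 : ∀ x, ⟪x, H (B x)⟫ ≤ ⟪x, H x⟫) (h2 : ∀ x, -⟪x, H x⟫ ≤ ⟪x, H (B x)⟫) (x : E) :
    ⟪x, H (B (B x))⟫ ≤ ⟪x, H x⟫ := by
  -- The two tests add up through `(1 + B)(1 - B)² + (1 - B)(1 + B)² = 2 (1 - B²)`.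
  have a := h2 (x - B x)
  have b := h1 (x + B x)
  simp only [map_add, map_sub, inner_add_left, inner_add_right, inner_sub_left, inner_sub_right,
    hB] at a b
  linarith

/-- No spectral theorem is needed: the Pell identity writes `T² = 1 - U (1 - X²) U`, and `1 - B²` is
nonnegative in the form of `H`. -/
theorem inner_chebyshev_le (H B : E →L[ℝ] E) (hB : ∀ x y, ⟪B x, H y⟫ = ⟪x, H (B y)⟫)
    (h1 : ∀ x, ⟪x, H (B x)⟫ ≤ ⟪x, H x⟫) (h2 : ∀ x, -⟪x, H x⟫ ≤ ⟪x, H (B x)⟫) (n : ℕ) (x : E) :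
    ⟪Polynomial.aeval B (Polynomial.Chebyshev.T ℝ (n : ℤ)) x,
      H (Polynomial.aeval B (Polynomial.Chebyshev.T ℝ (n : ℤ)) x)⟫ ≤ ⟪x, H x⟫ := by
  obtain ⟨m, hm⟩ : ∃ m : ℤ, (n : ℤ) = m + 1 := ⟨n - 1, by ring⟩
  rw [hm, inner_aeval_comm H B hB]
  set T := Polynomial.Chebyshev.T ℝ (m + 1)
  set U := Polynomial.Chebyshev.U ℝ m
  have hp : T * T = 1 - U * (U - Polynomial.X * (Polynomial.X * U)) := by
    linear_combination chebyshev_T_sq_add m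
  rw [← mul_apply_eq_comp (Polynomial.aeval B T), ← map_mul, hp]
  have h := inner_sub_sq_nonneg H B hB h1 h2 (Polynomial.aeval B U x)
  have h3 : ⟪x, H (Polynomial.aeval B (U * (U - Polynomial.X * (Polynomial.X * U))) x)⟫
      = ⟪Polynomial.aeval B U x, H (Polynomial.aeval B U x)⟫
        - ⟪Polynomial.aeval B U x, H (B (B (Polynomial.aeval B U x)))⟫ := by
    rw [map_mul, mul_apply_eq_comp, ← inner_aeval_comm H B hB]
    simp [inner_sub_right]
  rw [map_sub, sub_apply, map_sub, inner_sub_right, h3]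
  simp only [map_one, one_apply_eq_self]
  linarith

/-- With `s = √κ` the point is `cosh θ` for `θ = log ((s+1)/(s-1))`, and `T_n (cosh θ) = cosh (n θ)
≥ exp (n θ) / 2`. From `log z ≥ 1 - 1/z` one gets `θ ≥ 2/(s+1) ≥ 1/s`. -/
theorem chebyshev_eval_ge (κ : ℝ) (hκ : 1 < κ) (n : ℕ) :
    Real.exp (n / √κ) / 2 ≤ (Polynomial.Chebyshev.T ℝ (n : ℤ)).eval ((κ + 1) / (κ - 1)) := by
  have hs : 1 < √κ := by rw [Real.lt_sqrt] <;> linarith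
  have hsq : √κ ^ 2 = κ := Real.sq_sqrt (by linarith)
  set s := √κ
  have hz : 0 < (s + 1) / (s - 1) := div_pos (by linarith) (by linarith)
  have hcosh : Real.cosh (Real.log ((s + 1) / (s - 1))) = (κ + 1) / (κ - 1) := by
    rw [Real.cosh_log hz, ← hsq]
    have : s - 1 ≠ 0 := by linarith
    have : s + 1 ≠ 0 := by linarith
    have : s ^ 2 - 1 ≠ 0 := by nlinarith
    field_simp
    ring
  rw [← hcosh, Polynomial.Chebyshev.T_real_cosh, Real.cosh_eq]
  have hlog : 1 / s ≤ Real.log ((s + 1) / (s - 1)) := by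
    refine le_trans ?_ (Real.one_sub_inv_le_log_of_pos hz)
    rw [inv_div, one_sub_div (by linarith), div_le_div_iff₀ (by linarith) (by linarith)]
    linarith
  have : Real.exp (n / s) ≤ Real.exp ((n : ℤ) * Real.log ((s + 1) / (s - 1))) := by
    apply Real.exp_le_exp.mpr
    rw [div_eq_mul_one_div]
    push_cast
    gcongr
  have := Real.exp_pos (-(((n : ℤ) : ℝ) * Real.log ((s + 1) / (s - 1))))
  linarith

/-- The polynomial estimate behind the convergence rate of preconditioned conjugate gradients. -/
theorem exists_polynomial_inner_le (H P Q : E →L[ℝ] E)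
    (hHs : ∀ x y, ⟪H x, y⟫ = ⟪x, H y⟫) (hPs : ∀ x y, ⟪P x, y⟫ = ⟪x, P y⟫)
    (hPQ : ∀ x, P (Q x) = x) (hH : ∀ x, 0 ≤ ⟪x, H x⟫)
    (hHP : ∀ x, ⟪x, H x⟫ ≤ ⟪x, P x⟫) (κ : ℝ) (hκ : 1 < κ) (hPH : ∀ x, ⟪x, P x⟫ ≤ κ * ⟪x, H x⟫)
    (n : ℕ) :
    ∃ p : Polynomial ℝ, p.natDegree ≤ n ∧ p.eval 0 = 1 ∧ ∀ x,
      ⟪Polynomial.aeval (Q * H) p x, H (Polynomial.aeval (Q * H) p x)⟫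
        ≤ (2 * Real.exp (-(n / √κ))) ^ 2 * ⟪x, H x⟫ := by
  have hA : ∀ x y, ⟪(Q * H) x, H y⟫ = ⟪x, H ((Q * H) y)⟫ := by
    intro x y
    simp only [mul_apply_eq_comp]
    rw [← hHs x]
    conv_lhs => rw [← hPQ (H y)]
    conv_rhs => rw [← hPQ (H x)]
    rw [hPs]
  have hle : ∀ x, ⟪x, H ((Q * H) x)⟫ ≤ ⟪x, H x⟫ := by
    intro x
    have hz : P ((Q * H) x) = H x := hPQ _
    set z := (Q * H) x
    have e1 := hH (x - z)
    have e2 := hHP z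
    simp only [map_sub, inner_sub_left, inner_sub_right] at e1
    rw [← hHs x z] at *
    rw [hz] at e2
    rw [real_inner_comm z (H x)] at *
    linarith
  -- The test vector `κ z - x` in the form of `P` gives the lower spectral bound `1/κ` for `Q H`.
  have hge : ∀ x, ⟪x, H x⟫ ≤ κ * ⟪x, H ((Q * H) x)⟫ := by
    intro x
    have hz : P ((Q * H) x) = H x := hPQ _
    set z := (Q * H) x
    have e1 := (hH (κ • z - x)).trans (hHP _)
    have e2 := hPH x
    simp only [map_sub, map_smul, inner_sub_left, inner_sub_right, inner_smul_left,
      inner_smul_right, hz, ← hPs z x, ← hHs x z, real_inner_comm z (H x),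
      real_inner_comm x (H x), RCLike.conj_to_real] at e1 ⊢
    nlinarith
  -- The affine map `l = c X + b` sends `[1/κ, 1]` onto `[-1, 1]`, and `l 0 = b`; dividing `T_n ∘ l`
  -- by `T_n b` makes its value at `0` equal to `1`.
  set c : ℝ := 2 * κ / (κ - 1) with hc
  set b : ℝ := -((κ + 1) / (κ - 1)) with hb
  have hκ1 : 0 < κ - 1 := by linarith
  set l : Polynomial ℝ := Polynomial.C c * Polynomial.X + Polynomial.C b with hl
  set B : E →L[ℝ] E := Polynomial.aeval (Q * H) l with hBdef
  have hBx : ∀ x, B x = c • (Q * H) x + b • x := by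
    intro x
    simp [hBdef, hl, Algebra.algebraMap_eq_smul_one]
  have hB : ∀ x y, ⟪B x, H y⟫ = ⟪x, H (B y)⟫ := inner_aeval_comm H _ hA l
  have hc0 : 0 < c := by positivity
  have h1 : ∀ x, ⟪x, H (B x)⟫ ≤ ⟪x, H x⟫ := by
    intro x
    rw [hBx, map_add, map_smul, map_smul, inner_add_right, inner_smul_right, inner_smul_right]
    have h3 : b = 1 - c := by rw [hc, hb]; field_simp; ring
    have h4 := mul_le_mul_of_nonneg_left (hle x) hc0.le
    rw [h3]
    linarith
  have h2 : ∀ x, -⟪x, H x⟫ ≤ ⟪x, H (B x)⟫ := by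
    intro x
    rw [hBx, map_add, map_smul, map_smul, inner_add_right, inner_smul_right, inner_smul_right]
    have h4 : 1 + b ≤ 0 := by
      rw [hb, ← sub_eq_add_neg, sub_nonpos, one_le_div hκ1]; linarith
    have h5 : c = κ * (-(1 + b)) := by rw [hc, hb]; field_simp; ring
    have h6 := mul_le_mul_of_nonneg_left (hge x) (neg_nonneg.mpr h4)
    rw [h5]
    linarith
  set τ := (Polynomial.Chebyshev.T ℝ (n : ℤ)).eval b with hτ
  have hτ2 : (Real.exp (n / √κ) / 2) ^ 2 ≤ τ ^ 2 := by
    rw [hτ, hb, Polynomial.Chebyshev.T_eval_neg, mul_pow]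
    have : (((n : ℤ).negOnePow : ℤ) : ℝ) ^ 2 = 1 := by
      rcases Int.even_or_odd (n : ℤ) with h | h
      · simp [Int.negOnePow_even _ h]
      · simp [Int.negOnePow_odd _ h]
    rw [this, one_mul]
    have := chebyshev_eval_ge κ hκ n
    gcongr
  have hτ0 : 0 < τ ^ 2 := lt_of_lt_of_le (by positivity) hτ2
  have hτne : τ ≠ 0 := fun h => by simp [h] at hτ0
  refine ⟨Polynomial.C τ⁻¹ * (Polynomial.Chebyshev.T ℝ (n : ℤ)).comp l, ?_, ?_, ?_⟩
  · refine (Polynomial.natDegree_C_mul_le _ _).trans (Polynomial.natDegree_comp_le.trans ?_)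
    rw [Polynomial.Chebyshev.natDegree_T, Int.natAbs_natCast]
    have : l.natDegree ≤ 1 := Polynomial.natDegree_linear_le
    nlinarith
  · have : l.eval 0 = b := by simp [hl]
    simp [Polynomial.eval_comp, this, ← hτ, hτne]
  · intro x
    have h := inner_chebyshev_le H B hB h1 h2 n x
    have hcomp : Polynomial.aeval (Q * H)
        (Polynomial.C τ⁻¹ * (Polynomial.Chebyshev.T ℝ (n : ℤ)).comp l) x
        = τ⁻¹ • Polynomial.aeval B (Polynomial.Chebyshev.T ℝ (n : ℤ)) x := by
      rw [map_mul, Polynomial.aeval_C, Polynomial.aeval_comp, ← hBdef,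
        Algebra.algebraMap_eq_smul_one]
      simp
    rw [hcomp, map_smul, inner_smul_left, inner_smul_right, RCLike.conj_to_real, ← mul_assoc]
    have h0 : τ⁻¹ * τ⁻¹ ≤ (2 * Real.exp (-(n / √κ))) ^ 2 := by
      rw [← pow_two, inv_pow, inv_le_comm₀ hτ0 (by positivity)]
      refine le_trans (le_of_eq ?_) hτ2
      rw [Real.exp_neg, ← inv_pow]
      congr 1
      field_simp
    exact mul_le_mul h0 h (hH _) (by positivity)

/-- This is `H² ≼ L H`, tested on `L x - H x`. With `inner_le_norm_sq_div` it converts between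
Euclidean residuals and energy errors. -/
theorem norm_sq_le_of_inner_le (H : E →L[ℝ] E) (hHs : ∀ x y, ⟪H x, y⟫ = ⟪x, H y⟫)
    (hH : ∀ x, 0 ≤ ⟪x, H x⟫) {L : ℝ} (hL : 0 < L) (hU : ∀ x, ⟪x, H x⟫ ≤ L * ‖x‖ ^ 2) (x : E) :
    ‖H x‖ ^ 2 ≤ L * ⟪x, H x⟫ := by
  have a := hH (L • x - H x)
  have b := hU (H x)
  simp only [map_sub, map_smul, inner_sub_left, inner_sub_right, inner_smul_left,
    inner_smul_right, RCLike.conj_to_real, ← hHs x (H x), real_inner_self_eq_norm_sq] at a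
  nlinarith

theorem inner_le_norm_sq_div (H : E →L[ℝ] E) {lam : ℝ} (hlam : 0 < lam)
    (hl : ∀ x, lam * ‖x‖ ^ 2 ≤ ⟪x, H x⟫) (x : E) :
    lam * ⟪x, H x⟫ ≤ ‖H x‖ ^ 2 := by
  have a := hl x
  have b := real_inner_le_norm x (H x)
  nlinarith [sq_nonneg (lam * ‖x‖ - ‖H x‖)]

end OperatorBounds

/-- Positivity makes `P` injective, hence invertible in finite dimension, so `inverse` is not the
default value `0`. -/
theorem apply_inverse_of_inner_pos {d : ℕ} (P : Vec d →L[ℝ] Vec d)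
    (hP : ∀ x, x ≠ 0 → 0 < ⟪x, P x⟫) (x : Vec d) : P (P.inverse x) = x := by
  have hinj : Function.Injective (P : Vec d →ₗ[ℝ] Vec d) := by
    rw [← LinearMap.ker_eq_bot, LinearMap.ker_eq_bot']
    intro m hm
    by_contra h
    have := hP m h
    rw [show P m = 0 from hm, inner_zero_right] at this
    exact lt_irrefl _ this
  set e := (LinearEquiv.ofInjectiveEndo (P : Vec d →ₗ[ℝ] Vec d) hinj).toContinuousLinearEquiv
  have he : P = (e : Vec d →L[ℝ] Vec d) := by ext1 y; rfl
  rw [he, ContinuousLinearMap.inverse_equiv]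
  simp

/-! ### Conjugate gradients: orthogonality, optimality and rate -/

section PCG

variable {d : ℕ} (P H : Vec d →L[ℝ] Vec d) (g : Vec d)

theorem pcgIterate_succ (t : ℕ) :
    pcgIterate P H g (t + 1) = pcgStep P H (pcgIterate P H g t) :=
  Function.iterate_succ_apply' _ _ _

theorem pcgIterate_s (t : ℕ) : (pcgIterate P H g t).s = P.inverse (pcgIterate P H g t).r := by
  cases t with
  | zero => rfl
  | succ t => rw [pcgIterate_succ]; rfl

theorem pcgIterate_r (t : ℕ) : (pcgIterate P H g t).r = g - H (pcgIterate P H g t).v := by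
  induction t with
  | zero => simp [pcgIterate, pcgInit]
  | succ t ih => rw [pcgIterate_succ]; simp [pcgStep, ih, sub_sub]

/-- The numerator of `pcgAlpha` vanishes, so the residual is frozen whatever the denominator is. -/
theorem pcgIterate_r_eq_zero_succ (t : ℕ) (h : (pcgIterate P H g t).r = 0) :
    (pcgIterate P H g (t + 1)).r = 0 := by
  rw [pcgIterate_succ]
  simp [pcgStep, pcgAlpha, h]

theorem pcgIterate_r_eq_zero_of_le {s t : ℕ} (hst : s ≤ t) (h : (pcgIterate P H g s).r = 0) :
    (pcgIterate P H g t).r = 0 := by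
  induction t, hst using Nat.le_induction with
  | base => exact h
  | succ t _ ih => exact pcgIterate_r_eq_zero_succ P H g t ih

/-- The span of the first `t` search directions. -/
def krylov : ℕ → Submodule ℝ (Vec d)
  | 0 => ⊥
  | t + 1 => krylov t ⊔ Submodule.span ℝ {(pcgIterate P H g t).u}

theorem krylov_le_succ (t : ℕ) : krylov P H g t ≤ krylov P H g (t + 1) := le_sup_left

theorem krylov_mono : Monotone (krylov P H g) := monotone_nat_of_le_succ (krylov_le_succ P H g)

theorem u_mem_krylov (t : ℕ) : (pcgIterate P H g t).u ∈ krylov P H g (t + 1) :=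
  Submodule.mem_sup_right (Submodule.mem_span_singleton_self _)

theorem mem_krylov_succ {t : ℕ} {y : Vec d} (hy : y ∈ krylov P H g (t + 1)) :
    ∃ z ∈ krylov P H g t, ∃ c : ℝ, y = z + c • (pcgIterate P H g t).u := by
  obtain ⟨z, hz, w, hw, rfl⟩ := Submodule.mem_sup.mp hy
  obtain ⟨c, rfl⟩ := Submodule.mem_span_singleton.mp hw
  exact ⟨z, hz, c, rfl⟩

theorem v_mem_krylov (t : ℕ) : (pcgIterate P H g t).v ∈ krylov P H g t := by
  induction t with
  | zero => simp [pcgIterate, pcgInit]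
  | succ t ih =>
    rw [pcgIterate_succ]
    exact Submodule.add_mem _ (krylov_le_succ P H g t ih)
      (Submodule.smul_mem _ _ (u_mem_krylov P H g t))

/-- The orthogonality relations of the conjugate gradient iteration. -/
structure IsConjugate (t : ℕ) : Prop where
  r_orth : ∀ y ∈ krylov P H g t, ⟪(pcgIterate P H g t).r, y⟫ = 0
  u_conj : ∀ y ∈ krylov P H g t, ⟪(pcgIterate P H g t).u, H y⟫ = 0
  s_mem : (pcgIterate P H g t).s ∈ krylov P H g (t + 1)
  apply_mem : ∀ y ∈ krylov P H g t, P.inverse (H y) ∈ krylov P H g (t + 1)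
  inner_u : ⟪(pcgIterate P H g t).r, (pcgIterate P H g t).u⟫
    = ⟪(pcgIterate P H g t).r, (pcgIterate P H g t).s⟫

theorem isConjugate_zero : IsConjugate P H g 0 where
  r_orth y hy := by rw [(Submodule.mem_bot ℝ).mp hy, inner_zero_right]
  u_conj y hy := by rw [(Submodule.mem_bot ℝ).mp hy, map_zero, inner_zero_right]
  s_mem := u_mem_krylov P H g 0
  apply_mem y hy := by rw [(Submodule.mem_bot ℝ).mp hy, map_zero, map_zero]; exact zero_mem _
  inner_u := rfl

theorem inner_inverse_comm (hPs : ∀ x y, ⟪P x, y⟫ = ⟪x, P y⟫)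
    (hPpos : ∀ x, x ≠ 0 → 0 < ⟪x, P x⟫) (x y : Vec d) :
    ⟪P.inverse x, y⟫ = ⟪x, P.inverse y⟫ := by
  conv_lhs => rw [← apply_inverse_of_inner_pos P hPpos y]
  conv_rhs => rw [← apply_inverse_of_inner_pos P hPpos x]
  rw [hPs]

theorem inner_inverse_pos (hPpos : ∀ x, x ≠ 0 → 0 < ⟪x, P x⟫) (x : Vec d) (hx : x ≠ 0) :
    0 < ⟪x, P.inverse x⟫ := by
  have h := apply_inverse_of_inner_pos P hPpos x
  have h2 := hPpos (P.inverse x) (fun h0 => hx (by rw [← h, h0, map_zero]))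
  rwa [h, real_inner_comm] at h2

/-- The residual must be nonzero so that both quotients of the iteration have positive denominators.
-/
theorem IsConjugate.succ (hHs : ∀ x y, ⟪H x, y⟫ = ⟪x, H y⟫) (hPs : ∀ x y, ⟪P x, y⟫ = ⟪x, P y⟫)
    (hHpos : ∀ x, x ≠ 0 → 0 < ⟪x, H x⟫) (hPpos : ∀ x, x ≠ 0 → 0 < ⟪x, P x⟫) {t : ℕ}
    (hr : (pcgIterate P H g t).r ≠ 0) (h : IsConjugate P H g t) :
    IsConjugate P H g (t + 1) := by
  have hQ := inner_inverse_comm P hPs hPpos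
  have hs := pcgIterate_s P H g t
  have hs' := pcgIterate_s P H g (t + 1)
  have hrs : 0 < ⟪(pcgIterate P H g t).r, (pcgIterate P H g t).s⟫ := by
    rw [hs]; exact inner_inverse_pos P hPpos _ hr
  have hu0 : (pcgIterate P H g t).u ≠ 0 := by
    intro h0
    have := h.inner_u
    rw [h0, inner_zero_right] at this
    linarith
  have huHu := hHpos _ hu0
  have hr' : (pcgIterate P H g (t + 1)).r = (pcgIterate P H g t).r
      - pcgAlpha H (pcgIterate P H g t) • H (pcgIterate P H g t).u := by
    rw [pcgIterate_succ]; rfl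
  have hu' : (pcgIterate P H g (t + 1)).u = (pcgIterate P H g (t + 1)).s
      + (⟪(pcgIterate P H g (t + 1)).r, (pcgIterate P H g (t + 1)).s⟫
        / ⟪(pcgIterate P H g t).r, (pcgIterate P H g t).s⟫) • (pcgIterate P H g t).u := by
    rw [pcgIterate_succ]; rfl
  have hα : pcgAlpha H (pcgIterate P H g t)
      * ⟪(pcgIterate P H g t).u, H (pcgIterate P H g t).u⟫
      = ⟪(pcgIterate P H g t).r, (pcgIterate P H g t).s⟫ := div_mul_cancel₀ _ huHu.ne'
  have hα0 : pcgAlpha H (pcgIterate P H g t) ≠ 0 := by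
    intro h0; rw [h0, zero_mul] at hα; linarith
  have hmemu := u_mem_krylov P H g t
  have hmemu' := u_mem_krylov P H g (t + 1)
  have hle := krylov_le_succ P H g (t + 1)
  obtain ⟨hro, huc, hsm, ham, hiu⟩ := h
  set x := pcgIterate P H g t
  set x' := pcgIterate P H g (t + 1)
  set α := pcgAlpha H x
  set b := ⟪x'.r, x'.s⟫ / ⟪x.r, x.s⟫ with hb
  have hro' : ∀ y ∈ krylov P H g (t + 1), ⟪x'.r, y⟫ = 0 := by
    intro y hy
    obtain ⟨z, hz, c, rfl⟩ := mem_krylov_succ P H g hy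
    have e1 := hro z hz
    have e2 := huc z hz
    rw [hr', inner_sub_left, inner_smul_left, hHs, inner_add_right, map_add, map_smul,
      inner_add_right, inner_smul_right, inner_smul_right, e1, e2, RCLike.conj_to_real]
    change 0 + c * ⟪x.r, x.u⟫ - α * (0 + c * ⟪x.u, H x.u⟫) = 0
    rw [hiu]
    linear_combination -c * hα
  have hsm' : x'.s ∈ krylov P H g (t + 1 + 1) := by
    have : x'.s = x'.u - b • x.u := by rw [hu']; abel
    rw [this]
    exact Submodule.sub_mem _ hmemu' (Submodule.smul_mem _ _ (hle hmemu))
  -- Since `α ≠ 0`, this expresses `P⁻¹ H u` through two consecutive `s`, turning conjugacy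
  -- statements into orthogonality of residuals.
  have hAu : α • P.inverse (H x.u) = x.s - x'.s := by
    rw [hs', hr', map_sub, map_smul, ← hs]; abel
  refine ⟨hro', ?_, hsm', ?_, ?_⟩
  · intro y hy
    obtain ⟨z, hz, c, rfl⟩ := mem_krylov_succ P H g hy
    -- For older directions, `P⁻¹ H z` already lies in the space to which the new residual is
    -- orthogonal.
    have e1 : ⟪x'.u, H z⟫ = 0 := by
      rw [hu', inner_add_left, inner_smul_left, huc z hz, hs', hQ, hro' _ (ham z hz)]
      simp
    have e2 : ⟪x'.u, H x.u⟫ = 0 := by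
      have e3 : α * ⟪x'.s, H x.u⟫ = -⟪x'.r, x'.s⟫ := by
        rw [hs', hQ, ← inner_smul_right, hAu, inner_sub_right, hro' _ hsm, ← hs']
        ring
      have e4 : b * ⟪x.r, x.s⟫ = ⟪x'.r, x'.s⟫ := div_mul_cancel₀ _ hrs.ne'
      apply mul_left_cancel₀ hα0
      rw [hu', inner_add_left, inner_smul_left, RCLike.conj_to_real]
      linear_combination e3 + b * hα + e4
    rw [map_add, map_smul, inner_add_right, inner_smul_right, e1]
    change 0 + c * ⟪x'.u, H x.u⟫ = 0
    rw [e2]; ring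
  · intro y hy
    obtain ⟨z, hz, c, rfl⟩ := mem_krylov_succ P H g hy
    rw [map_add, map_smul, map_add, map_smul]
    refine Submodule.add_mem _ (hle (ham z hz)) (Submodule.smul_mem _ _ ?_)
    change P.inverse (H x.u) ∈ _
    rw [← inv_smul_smul₀ hα0 (P.inverse (H x.u)), hAu]
    exact Submodule.smul_mem _ _ (Submodule.sub_mem _ (hle hsm) hsm')
  · rw [hu', inner_add_right, inner_smul_right, hro' _ hmemu]; ring

/-- The `t`-th iterate minimizes the energy of the error over the Krylov space. -/
theorem pcgIterate_energy_le (hHs : ∀ x y, ⟪H x, y⟫ = ⟪x, H y⟫)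
    (hPs : ∀ x y, ⟪P x, y⟫ = ⟪x, P y⟫)
    (hHpos : ∀ x, x ≠ 0 → 0 < ⟪x, H x⟫) (hPpos : ∀ x, x ≠ 0 → 0 < ⟪x, P x⟫) (z : Vec d)
    (hz : H z = g) (t : ℕ) (ht : 1 ≤ t) (hr : ∀ i < t, (pcgIterate P H g i).r ≠ 0)
    (p : Polynomial ℝ) (hp : p.natDegree ≤ t) (hp0 : p.eval 0 = 1) :
    ⟪z - (pcgIterate P H g t).v, H (z - (pcgIterate P H g t).v)⟫
      ≤ ⟪Polynomial.aeval (P.inverse * H) p z, H (Polynomial.aeval (P.inverse * H) p z)⟫ := by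
  have hconj : ∀ s ≤ t, IsConjugate P H g s := by
    intro s
    induction s with
    | zero => exact fun _ => isConjugate_zero P H g
    | succ s ih => exact fun hs => (ih (by omega)).succ P H g hHs hPs hHpos hPpos (hr s (by omega))
  set A := P.inverse * H with hA
  have hpow : ∀ i < t, (A ^ i) (A z) ∈ krylov P H g (i + 1) := by
    intro i
    induction i with
    | zero =>
      intro _
      have : (A ^ 0) (A z) = (pcgIterate P H g 0).u := by
        simp [hA, mul_apply_eq_comp, hz, pcgIterate, pcgInit]
      rw [this]
      exact u_mem_krylov P H g 0
    | succ i ih =>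
      intro hi
      rw [pow_succ', mul_apply_eq_comp]
      exact (hconj (i + 1) hi.le).apply_mem _ (ih (by omega))
  have hq : ∀ q : Polynomial ℝ, q.natDegree < t →
      Polynomial.aeval A q (A z) ∈ krylov P H g t := by
    intro q hq
    rw [Polynomial.aeval_eq_sum_range, sum_apply]
    refine Submodule.sum_mem _ fun i hi => ?_
    rw [Finset.mem_range] at hi
    exact Submodule.smul_mem _ _ (krylov_mono P H g (by omega) (hpow i (by omega)))
  -- Since `p 0 = 1`, `p(A) z - z` is a polynomial of degree below `t` applied to `A z = P⁻¹ g`, the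
  -- first search direction.
  obtain ⟨y, hy, hpz⟩ : ∃ y ∈ krylov P H g t, Polynomial.aeval A p z = z - y := by
    refine ⟨-Polynomial.aeval A p.divX (A z), Submodule.neg_mem _ (hq _ ?_), ?_⟩
    · rw [Polynomial.natDegree_divX_eq_natDegree_tsub_one]; omega
    · have h := Polynomial.divX_mul_X_add p
      rw [Polynomial.coeff_zero_eq_eval_zero, hp0] at h
      conv_lhs => rw [← h]
      simp only [map_add, map_mul, Polynomial.aeval_X, map_one, add_apply,
        one_apply_eq_self, mul_apply_eq_comp (Polynomial.aeval A p.divX), sub_neg_eq_add]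
      abel
  rw [hpz]
  set v := (pcgIterate P H g t).v with hv
  have horth := (hconj t le_rfl).r_orth (v - y) (Submodule.sub_mem _ (v_mem_krylov P H g t) hy)
  rw [pcgIterate_r, ← hv, show g - H v = H (z - v) by rw [map_sub, hz], hHs] at horth
  have hnn : 0 ≤ ⟪v - y, H (v - y)⟫ := by
    by_cases h0 : v - y = 0
    · rw [h0, inner_zero_left]
    · exact (hHpos _ h0).le
  have : z - y = (z - v) + (v - y) := by abel
  have h2 : ⟪v - y, H (z - v)⟫ = 0 := by rw [← hHs, real_inner_comm]; exact horth
  -- Pythagoras in the energy form: `z - v` is `H`-orthogonal to `v - y`.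
  rw [this, map_add, inner_add_left, inner_add_right, inner_add_right, h2]
  change _ ≤ ⟪z - v, H (z - v)⟫ + ⟪z - v, H (v - y)⟫ + _
  rw [horth]
  linarith

theorem pcgCount_spec (tol : ℝ) (cap : ℕ) :
    1 ≤ pcgCount P H g tol cap ∧
      (‖(pcgIterate P H g (pcgCount P H g tol cap)).r‖ ≤ tol ∨ cap ≤ pcgCount P H g tol cap) :=
  Nat.sInf_mem (s := {t : ℕ | 1 ≤ t ∧ (‖(pcgIterate P H g t).r‖ ≤ tol ∨ cap ≤ t)})
    ⟨max 1 cap, le_max_left _ _, Or.inr (le_max_right _ _)⟩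

theorem pcgCount_le (tol : ℝ) {cap : ℕ} (h : 1 ≤ cap) : pcgCount P H g tol cap ≤ cap :=
  Nat.sInf_le ⟨h, Or.inr le_rfl⟩

/-- The residual after sufficiently many PCG iterations. -/
theorem norm_pcgIterate_r_le {lam L μ : ℝ} (hlam : 0 < lam) (hL : lam ≤ L) (hμ : 0 < μ)
    (hHs : ∀ x y, ⟪H x, y⟫ = ⟪x, H y⟫) (hPs : ∀ x y, ⟪P x, y⟫ = ⟪x, P y⟫)
    (hl : ∀ x, lam * ‖x‖ ^ 2 ≤ ⟪x, H x⟫) (hu : ∀ x, ⟪x, H x⟫ ≤ L * ‖x‖ ^ 2)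
    (hHP : ∀ x, ⟪x, H x⟫ ≤ ⟪x, P x⟫) (hPH : ∀ x, ⟪x, P x⟫ ≤ ⟪x, H x⟫ + 2 * μ * ‖x‖ ^ 2)
    (t : ℕ) (ht : pcgCap lam L μ ≤ t) (ht1 : 1 ≤ t) :
    ‖(pcgIterate P H g t).r‖ ≤ beta * (lam / L) ^ (1 / 2 : ℝ) * ‖g‖ := by
  have hL0 : 0 < L := hlam.trans_le hL
  have hβ : 0 < beta := by norm_num [beta]
  by_cases hr : ∃ i < t, (pcgIterate P H g i).r = 0
  · obtain ⟨i, hi, h0⟩ := hr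
    rw [pcgIterate_r_eq_zero_of_le P H g hi.le h0, norm_zero]
    positivity
  push Not at hr
  have hHpos : ∀ x, x ≠ 0 → 0 < ⟪x, H x⟫ := fun x hx =>
    lt_of_lt_of_le (mul_pos hlam (pow_pos (norm_pos_iff.mpr hx) 2)) (hl x)
  have hPpos : ∀ x, x ≠ 0 → 0 < ⟪x, P x⟫ := fun x hx => (hHpos x hx).trans_le (hHP x)
  have hHnn : ∀ x, 0 ≤ ⟪x, H x⟫ := fun x => le_trans (by positivity) (hl x)
  obtain ⟨z, hz⟩ : ∃ z, H z = g := ⟨_, apply_inverse_of_inner_pos H hHpos g⟩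
  set κ := 1 + 2 * μ / lam with hκ
  have hκ1 : 1 < κ := by rw [hκ]; have : 0 < 2 * μ / lam := by positivity
                         linarith
  have hPκ : ∀ x, ⟪x, P x⟫ ≤ κ * ⟪x, H x⟫ := by
    intro x
    have h1 := mul_le_mul_of_nonneg_left (hl x) (show 0 ≤ 2 * μ / lam by positivity)
    have h2 : 2 * μ / lam * (lam * ‖x‖ ^ 2) = 2 * μ * ‖x‖ ^ 2 := by field_simp
    rw [hκ]
    linarith [hPH x]
  obtain ⟨p, hp, hp0, hple⟩ := exists_polynomial_inner_le H P P.inverse hHs hPs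
    (apply_inverse_of_inner_pos P hPpos) hHnn hHP κ hκ1 hPκ t
  have hen := (pcgIterate_energy_le P H g hHs hPs hHpos hPpos z hz t ht1 hr p hp hp0).trans (hple z)
  set e := z - (pcgIterate P H g t).v with he
  have hre : (pcgIterate P H g t).r = H e := by rw [pcgIterate_r, he, map_sub, hz]
  have h1 := norm_sq_le_of_inner_le H hHs hHnn hL0 hu e
  have h2 := inner_le_norm_sq_div H hlam hl z
  rw [hz] at h2
  have hκ0 : 0 < √κ := Real.sqrt_pos.mpr (by linarith)
  -- The logarithm in `pcgCap` is chosen for this: the contraction factor `2 exp(-t/√κ)` is at most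
  -- `β λ / L`.
  have hη : Real.exp (-(t / √κ)) ≤ beta * lam / (2 * L) := by
    have h3 : √κ * Real.log (2 * L / (beta * lam)) ≤ t :=
      (Nat.le_ceil _).trans (by exact_mod_cast ht)
    have h4 : Real.log (2 * L / (beta * lam)) ≤ t / √κ := by
      rw [le_div_iff₀ hκ0]; linarith
    calc Real.exp (-(t / √κ)) ≤ Real.exp (-Real.log (2 * L / (beta * lam))) := by gcongr
      _ = _ := by rw [Real.exp_neg, Real.exp_log (by positivity), inv_div]
  have hη2 : (2 * Real.exp (-(t / √κ))) ^ 2 ≤ (beta * lam / L) ^ 2 := by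
    have : beta * lam / L = 2 * (beta * lam / (2 * L)) := by field_simp
    rw [this]
    gcongr
  rw [← Real.sqrt_eq_rpow]
  refine (sq_le_sq₀ (norm_nonneg _) (by positivity)).mp ?_
  rw [mul_pow, mul_pow, Real.sq_sqrt (by positivity), hre]
  have h5 : ⟪z, H z⟫ ≤ ‖g‖ ^ 2 / lam := by rw [le_div_iff₀ hlam, hz]; linarith
  calc ‖H e‖ ^ 2 ≤ L * ((beta * lam / L) ^ 2 * (‖g‖ ^ 2 / lam)) :=
        h1.trans (by
          refine mul_le_mul_of_nonneg_left (hen.trans ?_) hL0.le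
          exact mul_le_mul hη2 h5 (hHnn z) (by positivity))
    _ = _ := by field_simp

end PCG

/-! ### Self-concordant functions of one variable and scalar estimates -/

section Scalar

theorem nonneg_of_second_deriv_nonneg {F F1 F2 : ℝ → ℝ}
    (hF : ∀ t ∈ Set.Icc (0 : ℝ) 1, HasDerivAt F (F1 t) t)
    (hF1 : ∀ t ∈ Set.Icc (0 : ℝ) 1, HasDerivAt F1 (F2 t) t)
    (hF2 : ∀ t ∈ Set.Icc (0 : ℝ) 1, 0 ≤ F2 t) (h0 : F 0 = 0) (h1 : F1 0 = 0) : 0 ≤ F 1 := by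
  have hint : interior (Set.Icc (0 : ℝ) 1) ⊆ Set.Icc 0 1 := interior_subset
  have m1 : MonotoneOn F1 (Set.Icc 0 1) :=
    monotoneOn_of_hasDerivWithinAt_nonneg (convex_Icc 0 1)
      (fun t ht => (hF1 t ht).continuousAt.continuousWithinAt)
      (fun t ht => (hF1 t (hint ht)).hasDerivWithinAt) (fun t ht => hF2 t (hint ht))
  have h0m : (0 : ℝ) ∈ Set.Icc (0 : ℝ) 1 := by simp
  have m0 : MonotoneOn F (Set.Icc 0 1) :=
    monotoneOn_of_hasDerivWithinAt_nonneg (convex_Icc 0 1)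
      (fun t ht => (hF t ht).continuousAt.continuousWithinAt)
      (fun t ht => (hF t (hint ht)).hasDerivWithinAt)
      (fun t ht => h1 ▸ m1 h0m (hint ht) (hint ht).1)
  exact h0 ▸ m0 h0m (by simp) zero_le_one

variable {φ φ1 φ2 φ3 : ℝ → ℝ}

/-- Self-concordance says exactly that the derivative of `φ''^(-1/2)` is at most `1` in absolute
value. -/
theorem abs_inv_sqrt_sub_le (h2 : ∀ t, HasDerivAt φ2 (φ3 t) t) (hpos : ∀ t, 0 < φ2 t)
    (hsc : ∀ t, |φ3 t| ≤ 2 * φ2 t ^ (3 / 2 : ℝ)) (t : ℝ) (ht : 0 ≤ t) :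
    |(√(φ2 t))⁻¹ - (√(φ2 0))⁻¹| ≤ t := by
  have hd : ∀ t, HasDerivAt (fun t => (√(φ2 t))⁻¹)
      (-(φ3 t / (2 * √(φ2 t))) / √(φ2 t) ^ 2) t := fun t =>
    ((h2 t).sqrt (hpos t).ne').inv (Real.sqrt_pos.mpr (hpos t)).ne'
  have hb : ∀ t, ‖-(φ3 t / (2 * √(φ2 t))) / √(φ2 t) ^ 2‖ ≤ 1 := by
    intro t
    have hs := Real.sqrt_pos.mpr (hpos t)
    have h3 : φ2 t ^ (3 / 2 : ℝ) = √(φ2 t) * √(φ2 t) ^ 2 := by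
      rw [Real.sqrt_eq_rpow, ← Real.rpow_natCast (φ2 t ^ (1 / 2 : ℝ)) 2,
        ← Real.rpow_mul (hpos t).le, ← Real.rpow_add (hpos t)]
      norm_num
    have := hsc t
    rw [h3] at this
    rw [Real.norm_eq_abs, abs_div, abs_neg, abs_div, abs_of_pos (by positivity : 0 < 2 * √(φ2 t)),
      abs_of_pos (by positivity : 0 < √(φ2 t) ^ 2), div_div, div_le_one (by positivity)]
    linarith
  have := convex_univ.norm_image_sub_le_of_norm_hasDerivWithin_le (C := 1)
    (fun x _ => (hd x).hasDerivWithinAt) (fun x _ => hb x) (Set.mem_univ 0) (Set.mem_univ t)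
  simpa [Real.norm_eq_abs, abs_of_nonneg ht] using this

/-- With `s = √(φ'' 0)`, the Lipschitz bound gives `φ'' t ≥ s² / (1 + t s)²`, which is integrated
twice. -/
theorem add_omega_le (h : ∀ t, HasDerivAt φ (φ1 t) t) (h1 : ∀ t, HasDerivAt φ1 (φ2 t) t)
    (h2 : ∀ t, HasDerivAt φ2 (φ3 t) t) (hpos : ∀ t, 0 < φ2 t)
    (hsc : ∀ t, |φ3 t| ≤ 2 * φ2 t ^ (3 / 2 : ℝ)) :
    φ 0 + φ1 0 + omega (√(φ2 0)) ≤ φ 1 := by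
  have hs := Real.sqrt_pos.mpr (hpos 0)
  have hψ := abs_inv_sqrt_sub_le h2 hpos hsc
  set s := √(φ2 0) with hsdef
  have hp : ∀ t ∈ Set.Icc (0 : ℝ) 1, 0 < 1 + t * s := fun t ht => by
    have := mul_nonneg ht.1 hs.le; linarith
  have key := nonneg_of_second_deriv_nonneg
    (F := fun t => φ t - φ 0 - φ1 0 * t - (t * s - Real.log (1 + t * s)))
    (F1 := fun t => φ1 t - φ1 0 - (s - s / (1 + t * s)))
    (F2 := fun t => φ2 t - s ^ 2 / (1 + t * s) ^ 2) ?_ ?_ ?_ (by simp) (by simp)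
  · simp only [mul_one, one_mul] at key
    rw [omega]; linarith
  · intro t ht
    have hl : HasDerivAt (fun t : ℝ => 1 + t * s) s t := by
      simpa using ((hasDerivAt_id t).mul_const s).const_add 1
    have hm : HasDerivAt (fun t : ℝ => t * s) s t := by
      simpa using (hasDerivAt_id t).mul_const s
    have hm2 : HasDerivAt (fun t : ℝ => φ1 0 * t) (φ1 0) t := by
      simpa using (hasDerivAt_id t).const_mul (φ1 0)
    exact (((h t).sub_const (φ 0)).sub hm2).sub (hm.sub (hl.log (hp t ht).ne'))
  · intro t ht
    have hl : HasDerivAt (fun t : ℝ => 1 + t * s) s t := by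
      simpa using ((hasDerivAt_id t).mul_const s).const_add 1
    have := ((h1 t).sub_const (φ1 0)).sub
      (((hasDerivAt_const t s).div hl (hp t ht).ne').const_sub s)
    refine this.congr_deriv ?_
    ring
  · intro t ht
    have h3 := (abs_le.mp (hψ t ht.1)).2
    have hst := Real.sqrt_pos.mpr (hpos t)
    have h4 : (√(φ2 t))⁻¹ ≤ (1 + t * s) / s := by
      rw [add_div, mul_div_cancel_right₀ _ hs.ne', one_div]; linarith
    have h5 : s / (1 + t * s) ≤ √(φ2 t) := by
      rw [inv_le_comm₀ hst (div_pos (hp t ht) hs), inv_div] at h4; exact h4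
    have h6 : (s / (1 + t * s)) ^ 2 ≤ √(φ2 t) ^ 2 :=
      pow_le_pow_left₀ (div_nonneg hs.le (hp t ht).le) h5 2
    rw [Real.sq_sqrt (hpos t).le, div_pow] at h6
    linarith

/-- The companion bound `φ'' t ≤ s² / (1 - t s)²`, integrated twice; `s < 1` keeps it finite on `[0,
1]`. -/
theorem le_sub_add_neg_log (h : ∀ t, HasDerivAt φ (φ1 t) t) (h1 : ∀ t, HasDerivAt φ1 (φ2 t) t)
    (h2 : ∀ t, HasDerivAt φ2 (φ3 t) t) (hpos : ∀ t, 0 < φ2 t)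
    (hsc : ∀ t, |φ3 t| ≤ 2 * φ2 t ^ (3 / 2 : ℝ)) (hlt : √(φ2 0) < 1) :
    φ 1 ≤ φ 0 + φ1 0 + (-√(φ2 0) - Real.log (1 - √(φ2 0))) := by
  have hs := Real.sqrt_pos.mpr (hpos 0)
  have hψ := abs_inv_sqrt_sub_le h2 hpos hsc
  set s := √(φ2 0) with hsdef
  have hp : ∀ t ∈ Set.Icc (0 : ℝ) 1, 0 < 1 - t * s := fun t ht => by
    have := mul_le_of_le_one_left hs.le ht.2; linarith
  have key := nonneg_of_second_deriv_nonneg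
    (F := fun t => (-(t * s) - Real.log (1 - t * s)) - (φ t - φ 0 - φ1 0 * t))
    (F1 := fun t => (-s - (-s) / (1 - t * s)) - (φ1 t - φ1 0))
    (F2 := fun t => s ^ 2 / (1 - t * s) ^ 2 - φ2 t) ?_ ?_ ?_ (by simp) (by simp)
  · simp only [mul_one, one_mul] at key
    linarith
  · intro t ht
    have hm : HasDerivAt (fun t : ℝ => t * s) s t := by
      simpa using (hasDerivAt_id t).mul_const s
    have hl : HasDerivAt (fun t : ℝ => 1 - t * s) (-s) t := hm.const_sub 1
    have hm2 : HasDerivAt (fun t : ℝ => φ1 0 * t) (φ1 0) t := by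
      simpa using (hasDerivAt_id t).const_mul (φ1 0)
    exact (hm.neg.sub (hl.log (hp t ht).ne')).sub (((h t).sub_const (φ 0)).sub hm2)
  · intro t ht
    have hm : HasDerivAt (fun t : ℝ => t * s) s t := by
      simpa using (hasDerivAt_id t).mul_const s
    have hl : HasDerivAt (fun t : ℝ => 1 - t * s) (-s) t := hm.const_sub 1
    have := (((hasDerivAt_const t (-s)).div hl (hp t ht).ne').const_sub (-s)).sub
      ((h1 t).sub_const (φ1 0))
    refine this.congr_deriv ?_
    ring
  · intro t ht
    have h3 := (abs_le.mp (hψ t ht.1)).1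
    have hst := Real.sqrt_pos.mpr (hpos t)
    have h4 : (1 - t * s) / s ≤ (√(φ2 t))⁻¹ := by
      rw [sub_div, mul_div_cancel_right₀ _ hs.ne', one_div]; linarith
    have h5 : √(φ2 t) ≤ s / (1 - t * s) := by
      rw [le_inv_comm₀ (div_pos (hp t ht) hs) hst, inv_div] at h4; exact h4
    have h6 := pow_le_pow_left₀ hst.le h5 2
    rw [Real.sq_sqrt (hpos t).le, div_pow] at h6
    linarith

theorem neg_sub_log_le {t : ℝ} (h0 : 0 ≤ t) (h1 : t < 1) :
    -t - Real.log (1 - t) ≤ t ^ 2 / (2 * (1 - t)) := by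
  have hp : ∀ x ∈ Set.Icc (0 : ℝ) t, 0 < 1 - x := fun x hx => by linarith [hx.2]
  have hd : ∀ x ∈ Set.Icc (0 : ℝ) t, HasDerivAt
      (fun x => x ^ 2 / (2 * (1 - x)) - (-x - Real.log (1 - x)))
      ((2 * x * (2 * (1 - x)) - x ^ 2 * (2 * (-1))) / (2 * (1 - x)) ^ 2
        - (-1 - (-1) / (1 - x))) x := by
    intro x hx
    have hl : HasDerivAt (fun x : ℝ => 1 - x) (-1) x := (hasDerivAt_id x).const_sub 1
    have hx2 : HasDerivAt (fun x : ℝ => x ^ 2) (2 * x) x := by simpa using hasDerivAt_pow 2 x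
    exact (hx2.div (hl.const_mul 2) (by have := hp x hx; positivity)).sub
      ((hasDerivAt_id x).neg.sub (hl.log (hp x hx).ne'))
  have m := monotoneOn_of_hasDerivWithinAt_nonneg (convex_Icc 0 t)
    (fun x hx => (hd x hx).continuousAt.continuousWithinAt)
    (fun x hx => (hd x (interior_subset hx)).hasDerivWithinAt) (fun x hx => by
      have hx' := hp x (interior_subset hx)
      have : (2 * x * (2 * (1 - x)) - x ^ 2 * (2 * (-1))) / (2 * (1 - x)) ^ 2
        - (-1 - (-1) / (1 - x)) = x ^ 2 / (2 * (1 - x) ^ 2) := by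
        field_simp
        ring
      rw [this]; positivity)
  have := m (Set.left_mem_Icc.mpr h0) (Set.right_mem_Icc.mpr h0) h0
  simp only [sub_zero, Real.log_one, neg_zero] at this
  norm_num at this
  linarith

/-- The scalar comparison between the decrease of a damped inexact Newton step and the gap. -/
theorem damped_step_scalar {u δ q e gap D : ℝ} (hu : 0 ≤ u) (hδ : 0 ≤ δ)
    (hq : 2 * q = u ^ 2 + δ ^ 2 - e) (he : e ≤ beta ^ 2 * u ^ 2) (hqle : q ≤ u * δ)
    (hgap : u < 1 → gap ≤ -u - Real.log (1 - u))
    (hD : q / (1 + δ) + δ / (1 + δ) - Real.log (1 + δ) ≤ D) :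
    gap - D ≤ max (gap - omega (1 / 6)) (gap / 2) := by
  have hβ : beta ^ 2 = 1 / 400 := by norm_num [beta]
  rw [hβ] at he
  have h1δ : 0 < 1 + δ := by linarith
  -- `q ≤ u δ` gives `(u - δ)² ≤ e`: the two norms differ by at most `β u`.
  have habs : (u - δ) ^ 2 ≤ (u / 20) ^ 2 := by nlinarith
  have hab := abs_le_of_sq_le_sq' habs (by positivity)
  by_cases hd : 1 / 5 ≤ δ
  · refine le_max_of_le_left ?_
    -- The tangent of `log` at `7/6` reduces the claim to a quadratic inequality in `δ`.
    have hlog : Real.log (1 + δ) ≤ Real.log (1 + 1 / 6) + (6 * δ - 1) / 7 := by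
      have h : Real.log ((1 + δ) / (1 + 1 / 6)) ≤ (1 + δ) / (1 + 1 / 6) - 1 :=
        Real.log_le_sub_one_of_pos (by positivity)
      rw [Real.log_div (by positivity) (by norm_num)] at h
      have h' : (1 + δ) / (1 + 1 / 6) - 1 = (6 * δ - 1) / 7 := by field_simp; ring
      linarith
    have hq2 : 20 / 21 * δ ^ 2 ≤ q := by
      have : δ ≤ 21 / 20 * u := by linarith [hab.1]
      have : δ ^ 2 ≤ (21 / 20 * u) ^ 2 := pow_le_pow_left₀ hδ this 2
      nlinarith
    have h3 : (6 * δ - 1) / 7 + 1 / 6 ≤ q / (1 + δ) + δ / (1 + δ) := by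
      rw [← add_div, le_div_iff₀ h1δ]
      nlinarith
    have h4 : omega (1 / 6) = 1 / 6 - Real.log (1 + 1 / 6) := rfl
    linarith
  · push Not at hd
    refine le_max_of_le_right ?_
    -- `δ ≥ (19/20) u` and `δ < 1/5`. Then the gap is at most `(19/30) u²` and the decrease at least
    -- `(133/320) u²`, more than half of it.
    have hu1 : u < 4 / 19 := by linarith [hab.2]
    have hg := (hgap (by linarith)).trans (neg_sub_log_le hu (by linarith))
    have hlog : -(δ / (1 + δ)) + Real.log (1 + δ) ≤ δ ^ 2 / (2 * (1 + δ)) := by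
      have h := neg_sub_log_le (t := δ / (1 + δ)) (by positivity) (by
        rw [div_lt_one h1δ]; linarith)
      have h1 : 1 - δ / (1 + δ) = (1 + δ)⁻¹ := by field_simp; ring
      rw [h1, Real.log_inv] at h
      have h2 : (δ / (1 + δ)) ^ 2 / (2 * (1 + δ)⁻¹) = δ ^ 2 / (2 * (1 + δ)) := by
        field_simp
      linarith
    have h3 : 133 / 320 * u ^ 2 ≤ q / (1 + δ) - δ ^ 2 / (2 * (1 + δ)) := by
      have : q / (1 + δ) - δ ^ 2 / (2 * (1 + δ)) = (2 * q - δ ^ 2) / (2 * (1 + δ)) := by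
        field_simp
      rw [this, le_div_iff₀ (by positivity), hq]
      nlinarith [mul_nonneg (sq_nonneg u) (by linarith : 0 ≤ 1 / 5 - δ)]
    have h4 : u ^ 2 / (2 * (1 - u)) ≤ 19 / 30 * u ^ 2 := by
      rw [div_le_iff₀ (by linarith)]
      nlinarith [mul_nonneg (sq_nonneg u) (by linarith : 0 ≤ 4 / 19 - u)]
    nlinarith [sq_nonneg u]

end Scalar

/-! ### Gradient and Hessian of smooth functions -/

section Calculus

variable {d : ℕ} {F : Vec d → ℝ}

theorem contDiff_gradient {n : WithTop ℕ∞} (hF : ContDiff ℝ (n + 1) F) :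
    ContDiff ℝ n (gradient F) := by
  rw [contDiff_euclidean]
  intro i
  have h : (fun x => gradient F x i) = fun x => fderiv ℝ F x (EuclideanSpace.single i 1) := by
    ext x
    rw [← inner_gradient_left, EuclideanSpace.inner_single_right]
    simp
  rw [h]
  exact (hF.fderiv_right le_rfl).clm_apply contDiff_const

theorem differentiable_gradient (hF : ContDiff ℝ 2 F) : Differentiable ℝ (gradient F) :=
  (contDiff_gradient (n := 1) (by norm_num; exact hF)).differentiable one_ne_zero

theorem contDiff_hess (hF : ContDiff ℝ 3 F) : ContDiff ℝ 1 (hess F) :=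
  (contDiff_gradient (n := 2) (by norm_num; exact hF)).fderiv_right (by norm_num)

theorem inner_hess_left (hF : ContDiff ℝ 2 F) (w x y : Vec d) :
    ⟪hess F w x, y⟫ = fderiv ℝ (fderiv ℝ F) w x y := by
  have h1 : (fun z => ⟪gradient F z, y⟫) = fun z => fderiv ℝ F z y := by
    ext z; exact inner_gradient_left
  have h2 := congrArg (fun k => fderiv ℝ k w x) h1
  have hg := (differentiable_gradient hF w).hasFDerivAt.inner ℝ (hasFDerivAt_const y w)
  have hf : DifferentiableAt ℝ (fderiv ℝ F) w :=
    (hF.fderiv_right (m := 1) (by norm_num)).differentiable one_ne_zero w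
  have hf2 := hf.hasFDerivAt.clm_apply (hasFDerivAt_const y w)
  rw [hg.fderiv, hf2.fderiv] at h2
  simpa [hess] using h2

theorem hess_symm (hF : ContDiff ℝ 2 F) (w x y : Vec d) :
    ⟪hess F w x, y⟫ = ⟪x, hess F w y⟫ := by
  rw [inner_hess_left hF, real_inner_comm, inner_hess_left hF]
  exact (hF.contDiffAt.isSymmSndFDerivAt (by simp)) x y

theorem hasDerivAt_line (w h : Vec d) (t : ℝ) : HasDerivAt (fun t : ℝ => w + t • h) h t := by
  simpa using ((hasDerivAt_id t).smul_const h).const_add w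

end Calculus

/-! ### Inexact damped Newton steps -/

section Newton

variable {d : ℕ} {F : Vec d → ℝ} {lam L : ℝ}

theorem HessianBounds.line_derivs (hH : HessianBounds F lam L) (hsc : IsSelfConcordant F 2)
    (w h : Vec d) (hh : h ≠ 0) :
    (∀ t : ℝ, HasDerivAt (fun t : ℝ => F (w + t • h)) ⟪gradient F (w + t • h), h⟫ t) ∧
    (∀ t : ℝ, HasDerivAt (fun t : ℝ => ⟪gradient F (w + t • h), h⟫)
      ⟪h, hess F (w + t • h) h⟫ t) ∧
    (∀ t : ℝ, HasDerivAt (fun t : ℝ => ⟪h, hess F (w + t • h) h⟫)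
      ⟪h, lineDeriv ℝ (hess F) (w + t • h) h h⟫ t) ∧
    (∀ t : ℝ, 0 < ⟪h, hess F (w + t • h) h⟫) ∧
    (∀ t : ℝ, |⟪h, lineDeriv ℝ (hess F) (w + t • h) h h⟫|
      ≤ 2 * ⟪h, hess F (w + t • h) h⟫ ^ (3 / 2 : ℝ)) := by
  refine ⟨fun t => ?_, fun t => ?_, fun t => ?_, fun t => ?_, fun t => hsc.bound _ _⟩
  · have hd := hH.contDiff.differentiable two_ne_zero (w + t • h)
    rw [inner_gradient_left]
    exact hd.hasFDerivAt.comp_hasDerivAt t (hasDerivAt_line w h t)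
  · have hd := differentiable_gradient hH.contDiff (w + t • h)
    have := (hd.hasFDerivAt.comp_hasDerivAt t (hasDerivAt_line w h t)).inner ℝ
      (hasDerivAt_const t h)
    refine this.congr_deriv ?_
    rw [inner_zero_right, zero_add, real_inner_comm]
    rfl
  · have hd := (contDiff_hess hsc.contDiff).differentiable one_ne_zero (w + t • h)
    rw [hd.lineDeriv_eq_fderiv]
    have h1 : HasDerivAt (fun t : ℝ => hess F (w + t • h))
        (fderiv ℝ (hess F) (w + t • h) h) t :=
      hd.hasFDerivAt.comp_hasDerivAt t (hasDerivAt_line w h t)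
    have h2 := h1.clm_apply (hasDerivAt_const t h)
    rw [map_zero, add_zero] at h2
    have h3 := (hasDerivAt_const t h).inner ℝ h2
    rwa [inner_zero_left, add_zero] at h3
  · exact lt_of_lt_of_le (mul_pos hH.lam_pos (pow_pos (norm_pos_iff.mpr hh) 2)) (hH.lower _ _)

theorem HessianBounds.add_omega_le (hH : HessianBounds F lam L) (hsc : IsSelfConcordant F 2)
    (w h : Vec d) :
    F w + ⟪gradient F w, h⟫ + omega (√⟪h, hess F w h⟫) ≤ F (w + h) := by
  by_cases hh : h = 0
  · simp [hh, omega]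
  obtain ⟨a, b, c, e, f⟩ := hH.line_derivs hsc w h hh
  simpa using DiSCO.add_omega_le a b c e f

theorem HessianBounds.le_sub_add_neg_log (hH : HessianBounds F lam L)
    (hsc : IsSelfConcordant F 2) (w h : Vec d) (hlt : √⟪h, hess F w h⟫ < 1) :
    F (w + h) ≤ F w + ⟪gradient F w, h⟫
      + (-√⟪h, hess F w h⟫ - Real.log (1 - √⟪h, hess F w h⟫)) := by
  by_cases hh : h = 0
  · simp [hh]
  obtain ⟨a, b, c, e, f⟩ := hH.line_derivs hsc w h hh
  simpa using DiSCO.le_sub_add_neg_log a b c e f (by simpa using hlt)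

theorem inner_le_sqrt_mul_sqrt (H : Vec d →L[ℝ] Vec d) (hHs : ∀ x y, ⟪H x, y⟫ = ⟪x, H y⟫)
    (hH : ∀ x, 0 ≤ ⟪x, H x⟫) (x y : Vec d) : ⟪x, H y⟫ ≤ √⟪x, H x⟫ * √⟪y, H y⟫ := by
  have hquad : ∀ t : ℝ, 0 ≤ ⟪y, H y⟫ * (t * t) + (2 * ⟪x, H y⟫) * t + ⟪x, H x⟫ := by
    intro t
    have h := hH (x + t • y)
    have hc : ⟪y, H x⟫ = ⟪x, H y⟫ := by rw [real_inner_comm, hHs]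
    simp only [map_add, map_smul, inner_add_left, inner_add_right, inner_smul_left,
      inner_smul_right, RCLike.conj_to_real, hc] at h
    linarith
  have hd := discrim_le_zero hquad
  rw [discrim] at hd
  rw [← Real.sqrt_mul (hH x)]
  apply Real.le_sqrt_of_sq_le
  linarith

/-- The gap is controlled by the Newton decrement. -/
theorem HessianBounds.gap_le (hH : HessianBounds F lam L) (hsc : IsSelfConcordant F 2)
    (w z y : Vec d) (hz : hess F w z = gradient F w) (hlt : √⟪z, hess F w z⟫ < 1) :
    F w - F y ≤ -√⟪z, hess F w z⟫ - Real.log (1 - √⟪z, hess F w z⟫) := by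
  have hnn : ∀ x, 0 ≤ ⟪x, hess F w x⟫ := fun x =>
    le_trans (mul_nonneg hH.lam_pos.le (sq_nonneg _)) (hH.lower w x)
  have hs := hess_symm hH.contDiff w
  have h1 := hH.add_omega_le hsc w (y - w)
  have h2 := inner_le_sqrt_mul_sqrt (hess F w) hs hnn (-(y - w)) z
  rw [hz, inner_neg_left, map_neg, inner_neg_neg, real_inner_comm, ← hz] at h2
  rw [add_sub_cancel, omega, ← hz] at h1
  set ρ := √⟪y - w, hess F w (y - w)⟫
  set u := √⟪z, hess F w z⟫
  have hρ : 0 ≤ ρ := Real.sqrt_nonneg _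
  -- Fenchel–Young for `ω` and its conjugate: `log x ≤ x - 1` at `x = (1 + ρ)(1 - u)`.
  have hlog := Real.log_le_sub_one_of_pos (mul_pos (by linarith : 0 < 1 + ρ)
    (by linarith : 0 < 1 - u))
  rw [Real.log_mul (by linarith) (by linarith)] at hlog
  nlinarith

/-- A damped inexact Newton step either decreases the gap by `ω(1/6)` or halves it. -/
theorem HessianBounds.gap_damped_step_le (hH : HessianBounds F lam L)
    (hsc : IsSelfConcordant F 2) (w v r y : Vec d) (hr : r = gradient F w - hess F w v)
    (htol : ‖r‖ ≤ beta * (lam / L) ^ (1 / 2 : ℝ) * ‖gradient F w‖) :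
    F (w - (1 / (1 + √⟪v, hess F w v⟫)) • v) - F y
      ≤ max (F w - F y - omega (1 / 6)) ((F w - F y) / 2) := by
  have hlam := hH.lam_pos
  have hL : 0 < L := hlam.trans_le hH.lam_le
  have hl := hH.lower w
  have hu := hH.upper w
  have hs := hess_symm hH.contDiff w
  have hgap := hH.gap_le hsc w
  have hdec := hH.le_sub_add_neg_log hsc w (-(1 / (1 + √⟪v, hess F w v⟫)) • v)
  have hnn : ∀ x, 0 ≤ ⟪x, hess F w x⟫ := fun x =>
    le_trans (mul_nonneg hlam.le (sq_nonneg _)) (hl x)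
  have hpos : ∀ x, x ≠ 0 → 0 < ⟪x, hess F w x⟫ := fun x hx =>
    lt_of_lt_of_le (mul_pos hlam (pow_pos (norm_pos_iff.mpr hx) 2)) (hl x)
  obtain ⟨z, hz⟩ : ∃ z, hess F w z = gradient F w :=
    ⟨_, apply_inverse_of_inner_pos _ hpos _⟩
  specialize hgap z y hz
  rw [← hz] at hr htol hdec
  set H := hess F w
  set δ := √⟪v, H v⟫ with hδ
  set u := √⟪z, H z⟫ with hudef
  have hδ0 : 0 ≤ δ := Real.sqrt_nonneg _
  have h1δ : 0 < 1 + δ := by linarith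
  have hδ2 : δ ^ 2 = ⟪v, H v⟫ := Real.sq_sqrt (hnn v)
  have hu2 : u ^ 2 = ⟪z, H z⟫ := Real.sq_sqrt (hnn z)
  -- Damping gives the step energy norm `δ / (1 + δ) < 1`, so the upper bound always applies.
  have hscale : √⟪-(1 / (1 + δ)) • v, H (-(1 / (1 + δ)) • v)⟫ = δ / (1 + δ) := by
    rw [map_smul, inner_smul_left, inner_smul_right, ← hδ2, RCLike.conj_to_real]
    rw [show -(1 / (1 + δ)) * (-(1 / (1 + δ)) * δ ^ 2) = (δ / (1 + δ)) ^ 2 by ring]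
    exact Real.sqrt_sq (by positivity)
  rw [hscale] at hdec
  have hlt : δ / (1 + δ) < 1 := by rw [div_lt_one h1δ]; linarith
  have h1sub : 1 - δ / (1 + δ) = (1 + δ)⁻¹ := by field_simp; ring
  have hdec := hdec hlt
  rw [h1sub, Real.log_inv, inner_smul_right, neg_smul, ← sub_eq_add_neg] at hdec
  have hq : ⟪H z, v⟫ = ⟪z, H v⟫ := hs z v
  have hq' : ⟪v, H z⟫ = ⟪z, H v⟫ := by rw [real_inner_comm, hq]
  -- The factor `√(λ/L)` in the tolerance pays for passing from Euclidean to energy norms.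
  have he : ⟪z - v, H (z - v)⟫ ≤ beta ^ 2 * u ^ 2 := by
    have e1 := inner_le_norm_sq_div H hlam hl (z - v)
    rw [show H (z - v) = r by rw [hr, map_sub]] at e1
    have e2 := norm_sq_le_of_inner_le H hs hnn hL hu z
    have e3 := pow_le_pow_left₀ (norm_nonneg _) htol 2
    rw [mul_pow, mul_pow, ← Real.sqrt_eq_rpow, Real.sq_sqrt (by positivity)] at e3
    have e4 : beta ^ 2 * (lam / L) * ‖H z‖ ^ 2 ≤ beta ^ 2 * (lam / L) * (L * ⟪z, H z⟫) :=
      mul_le_mul_of_nonneg_left e2 (by positivity)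
    have e5 : beta ^ 2 * (lam / L) * (L * ⟪z, H z⟫) = lam * (beta ^ 2 * u ^ 2) := by
      rw [hu2]; field_simp
    rw [show H (z - v) = r by rw [hr, map_sub]]
    exact le_of_mul_le_mul_left (by linarith) hlam
  have := damped_step_scalar (u := u) (δ := δ) (q := ⟪z, H v⟫) (gap := F w - F y)
    (e := ⟪z - v, H (z - v)⟫) (D := F w - F (w - (1 / (1 + δ)) • v)) (Real.sqrt_nonneg _) hδ0
    (by
      rw [hu2, hδ2, map_sub, inner_sub_left, inner_sub_right, inner_sub_right, hq']
      ring)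
    he (inner_le_sqrt_mul_sqrt H hs hnn z v) hgap (by
      rw [hq] at hdec
      have : -(1 / (1 + δ)) * ⟪z, H v⟫ = -(⟪z, H v⟫ / (1 + δ)) := by ring
      linarith)
  linarith

end Newton

/-! ### Derivatives of the average -/

section Objective

variable {m d : ℕ} {f : Fin m → Vec d → ℝ}

theorem gradient_objective (hf : ∀ i, ContDiff ℝ 2 (f i)) (w : Vec d) :
    gradient (objective f) w = average fun i => gradient (f i) w := by
  refine ext_inner_right ℝ fun y => ?_
  have h : HasFDerivAt (objective f) ((1 / (m : ℝ)) • ∑ i, fderiv ℝ (f i) w) w :=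
    (HasFDerivAt.fun_sum fun i _ =>
      ((hf i).differentiable two_ne_zero w).hasFDerivAt).const_smul (1 / (m : ℝ))
  rw [inner_gradient_left, h.fderiv]
  simp [average, inner_smul_left, sum_inner]

theorem hess_objective (hf : ∀ i, ContDiff ℝ 2 (f i)) (w : Vec d) :
    hess (objective f) w = average fun i => hess (f i) w := by
  have hg : gradient (objective f) = fun w => average fun i => gradient (f i) w :=
    funext (gradient_objective hf)
  have h : HasFDerivAt (fun w => average fun i => gradient (f i) w)
      ((1 / (m : ℝ)) • ∑ i, hess (f i) w) w :=
    (HasFDerivAt.fun_sum fun i _ =>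
      (differentiable_gradient (hf i) w).hasFDerivAt).const_smul (1 / (m : ℝ))
  rw [hess, hg, h.fderiv, average]

end Objective

/-! ### One call of distributed PCG -/

section Call

variable {m d : ℕ} [NeZero m] {f : Fin m → Vec d → ℝ} {lam L : ℝ}

theorem pcgCall_r (hf : ∀ i, ContDiff ℝ 2 (f i)) (w : Vec d) (μ : ℝ) :
    (pcgCall f lam L w μ).r = gradient (objective f) w
      - hess (objective f) w (pcgCall f lam L w μ).v := by
  rw [gradient_objective hf, hess_objective hf]
  exact pcgIterate_r _ _ _ _

theorem pcgCall_δ (hf : ∀ i, ContDiff ℝ 2 (f i)) (w : Vec d) (μ : ℝ) :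
    (pcgCall f lam L w μ).δ = √⟪(pcgCall f lam L w μ).v,
      hess (objective f) w (pcgCall f lam L w μ).v⟫ := by
  rw [hess_objective hf]
  simp only [pcgCall]
  generalize (average fun i => hess (f i) w) = H
  generalize (average fun i => gradient (f i) w) = g
  generalize hess (f 0) w + μ • ContinuousLinearMap.id ℝ (Vec d) = P
  generalize beta * (lam / L) ^ (1 / 2 : ℝ) * ‖g‖ = tol
  -- At least one iteration is made, so index `N - 1` is the true predecessor and the formula for
  -- `δ` expands `vᵀ H v`.
  obtain ⟨k, hk⟩ := Nat.exists_eq_add_of_le' (pcgCount_spec P H g tol (pcgCap lam L μ)).1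
  rw [hk, Nat.add_sub_cancel]
  have hv : (pcgIterate P H g (k + 1)).v = (pcgIterate P H g k).v
      + pcgAlpha H (pcgIterate P H g k) • (pcgIterate P H g k).u := by
    rw [pcgIterate_succ]; rfl
  congr 1
  conv_rhs => rw [hv]
  rw [map_add, map_smul, inner_add_right, inner_smul_right, ← hv]

theorem pcgCall_tol (hf : ∀ i, ContDiff ℝ 2 (f i)) (w : Vec d) (μ : ℝ) :
    (pcgCall f lam L w μ).tol
      = beta * (lam / L) ^ (1 / 2 : ℝ) * ‖gradient (objective f) w‖ := by
  rw [gradient_objective hf]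
  rfl

theorem log_ratio_pos (hlam : 0 < lam) (hL : lam ≤ L) :
    0 < Real.log (2 * L / (beta * lam)) := by
  apply Real.log_pos
  rw [one_lt_div (by norm_num [beta]; exact hlam)]
  norm_num [beta]
  linarith

theorem pcgCap_pos (hlam : 0 < lam) (hL : lam ≤ L) {μ : ℝ} (hμ : 0 < μ) :
    1 ≤ pcgCap lam L μ :=
  Nat.ceil_pos.mpr (mul_pos (Real.sqrt_pos.mpr (by positivity)) (log_ratio_pos hlam hL))

/-- The `2` is one round for the gradient and one for rounding up. The cap is at least `1`, so the
compulsory first iteration does not exceed it. -/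
theorem pcgCall_rounds_le (hlam : 0 < lam) (hL : lam ≤ L) (w : Vec d) {μ : ℝ} (hμ : 0 < μ) :
    ((pcgCall f lam L w μ).rounds : ℝ)
      ≤ 2 + √(1 + 2 * μ / lam) * Real.log (2 * L / (beta * lam)) := by
  have hlog := log_ratio_pos hlam hL
  have h1 : (pcgCall f lam L w μ).rounds ≤ 1 + pcgCap lam L μ :=
    Nat.add_le_add_left (pcgCount_le _ _ _ _ (pcgCap_pos hlam hL hμ)) 1
  have h2 : (pcgCap lam L μ : ℝ) < √(1 + 2 * μ / lam) * Real.log (2 * L / (beta * lam)) + 1 :=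
    Nat.ceil_lt_add_one (by positivity)
  have h3 : ((pcgCall f lam L w μ).rounds : ℝ) ≤ 1 + pcgCap lam L μ := by exact_mod_cast h1
  linarith

/-- A PCG call succeeds as soon as `μ` dominates `‖f₁''(w) - f''(w)‖`. -/
theorem norm_pcgCall_r_le_tol (hf : ∀ i, ContDiff ℝ 2 (f i))
    (hH : HessianBounds (objective f) lam L) (w : Vec d) {μ : ℝ} (hμ : 0 < μ)
    (hdom : ‖hess (f 0) w - hess (objective f) w‖ ≤ μ) :
    ‖(pcgCall f lam L w μ).r‖ ≤ (pcgCall f lam L w μ).tol := by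
  have hquad : ∀ x, |⟪x, hess (f 0) w x⟫ - ⟪x, hess (objective f) w x⟫| ≤ μ * ‖x‖ ^ 2 := by
    intro x
    rw [← inner_sub_right, ← sub_apply]
    refine (abs_real_inner_le_norm _ _).trans ?_
    have h := (hess (f 0) w - hess (objective f) w).le_of_opNorm_le hdom x
    nlinarith [norm_nonneg x]
  have hPx : ∀ x, ⟪x, (hess (f 0) w + μ • ContinuousLinearMap.id ℝ (Vec d)) x⟫
      = ⟪x, hess (f 0) w x⟫ + μ * ‖x‖ ^ 2 := by
    intro x
    simp [inner_add_right, inner_smul_right]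
  have key : ∀ t, pcgCap lam L μ ≤ t → 1 ≤ t →
      ‖(pcgIterate (hess (f 0) w + μ • ContinuousLinearMap.id ℝ (Vec d)) (hess (objective f) w)
        (gradient (objective f) w) t).r‖
      ≤ beta * (lam / L) ^ (1 / 2 : ℝ) * ‖gradient (objective f) w‖ :=
    fun t ht ht1 => norm_pcgIterate_r_le _ _ _ hH.lam_pos hH.lam_le hμ (hess_symm hH.contDiff w)
      (fun x y => by
        have := hess_symm (hf 0) w x y
        simp [inner_add_left, inner_add_right, inner_smul_left, inner_smul_right, this])
      (hH.lower w) (hH.upper w)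
      (fun x => by rw [hPx]; linarith [(abs_le.mp (hquad x)).1])
      (fun x => by rw [hPx]; linarith [(abs_le.mp (hquad x)).2]) t ht ht1
  rw [gradient_objective hf, hess_objective hf] at key
  have hspec := pcgCount_spec (hess (f 0) w + μ • ContinuousLinearMap.id ℝ (Vec d))
    (average fun i => hess (f i) w) (average fun i => gradient (f i) w)
    (beta * (lam / L) ^ (1 / 2 : ℝ) * ‖average fun i => gradient (f i) w‖) (pcgCap lam L μ)
  exact hspec.2.elim id fun h => key _ h hspec.1

end Call

/-! ### The worst-case recursion for the gap -/

section GapRecursion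

/-- The worst-case effect of one successful PCG call on the gap. -/
def gapStep (A x : ℝ) : ℝ := max (x - A) (x / 2)

theorem gapStep_mono (A : ℝ) : Monotone (gapStep A) := fun x y h => by
  unfold gapStep
  gcongr

theorem gapStep_iterate_le_half {A : ℝ} (hA : 0 ≤ A) (N : ℕ) (x : ℝ) (hx : x ≤ N * A) :
    (gapStep A)^[N] x ≤ A / 2 := by
  induction N generalizing x with
  | zero =>
    simp only [Nat.cast_zero, zero_mul] at hx
    simp only [Function.iterate_zero, id]
    linarith
  | succ N ih =>
    rw [Function.iterate_succ_apply]
    -- Halving `(N + 1) A` stays below `N A` only for `N ≥ 1`; the last step is treated apart.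
    rcases Nat.eq_zero_or_pos N with rfl | hN
    · simp only [zero_add, Nat.cast_one, one_mul] at hx
      exact max_le (by linarith) (by linarith)
    · apply ih
      have hN' : (1 : ℝ) ≤ N := by exact_mod_cast hN
      push_cast at hx
      exact max_le (by linarith) (by nlinarith)

/-- Below `A / 2`, subtracting `A` already gives a nonpositive number, so the halving branch
supplies the bound. -/
theorem gapStep_iterate_le_geometric {A : ℝ} (hA : 0 ≤ A) (x : ℝ) (hx : x ≤ A / 2) (j : ℕ) :
    (gapStep A)^[j] x ≤ A / 2 / 2 ^ j := by
  induction j with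
  | zero => simpa using hx
  | succ j ih =>
    rw [Function.iterate_succ_apply', pow_succ, ← div_div]
    have : A / 2 / 2 ^ j ≤ A / 2 := div_le_self (by linarith) (one_le_pow₀ (by norm_num))
    exact max_le (by linarith) (by linarith)

theorem gapStep_iterate_lt {A : ℝ} (hA : 0 < A) (x : ℝ) {ε : ℝ} (hε : 0 < ε) (k : ℕ)
    (hk : ⌈x / A⌉₊ + ⌈Real.logb 2 (2 * A / ε)⌉₊ ≤ k) : (gapStep A)^[k] x < ε := by
  obtain ⟨j, rfl⟩ := Nat.exists_eq_add_of_le' ((Nat.le_add_right _ _).trans hk)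
  rw [Function.iterate_add_apply]
  have h1 := gapStep_iterate_le_half hA.le ⌈x / A⌉₊ x
    (by rw [← div_le_iff₀ hA]; exact Nat.le_ceil _)
  refine (gapStep_iterate_le_geometric hA.le _ h1 j).trans_lt ?_
  have h2 : Real.logb 2 (2 * A / ε) ≤ j :=
    (Nat.le_ceil _).trans (by exact_mod_cast (by omega : ⌈Real.logb 2 (2 * A / ε)⌉₊ ≤ j))
  rw [Real.logb_le_iff_le_rpow one_lt_two (by positivity), Real.rpow_natCast,
    div_le_iff₀ hε] at h2
  rw [div_lt_iff₀ (by positivity)]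
  linarith

theorem omega_pos {t : ℝ} (ht : 0 < t) : 0 < omega t := by
  have := Real.log_lt_sub_one_of_pos (by linarith : 0 < 1 + t) (by linarith)
  rw [omega]; linarith

end GapRecursion

/-! ### Counting calls, successes and rounds -/

section Run

open Classical

variable {m d : ℕ} [NeZero m] (f : Fin m → Vec d → ℝ) (lam L : ℝ)

/-- The PCG call made in state `S` reaches its tolerance. -/
def Succeeds (S : State d) : Prop :=
  ‖(pcgCall f lam L S.w S.μ).r‖ ≤ (pcgCall f lam L S.w S.μ).tol

/-- The number of successful PCG calls among the first `n`. -/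
def successCount (what : Fin m → Vec d) (μ₀ : ℝ) (n : ℕ) : ℕ :=
  Nat.count (fun j => Succeeds f lam L (run f lam L what μ₀ j)) n

variable {f lam L}

theorem step_of_succeeds {S : State d} (h : Succeeds f lam L S) :
    step f lam L S =
      { w := S.w - (1 / (1 + (pcgCall f lam L S.w S.μ).δ)) • (pcgCall f lam L S.w S.μ).v
        μ := S.μ / 2
        μmax := max S.μmax (S.μ / 2)
        rounds := S.rounds + (pcgCall f lam L S.w S.μ).rounds } :=
  if_neg (not_lt.mpr h)

theorem step_of_not_succeeds {S : State d} (h : ¬ Succeeds f lam L S) :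
    step f lam L S =
      { w := S.w
        μ := 2 * S.μ
        μmax := max S.μmax (2 * S.μ)
        rounds := S.rounds + (pcgCall f lam L S.w S.μ).rounds } :=
  if_pos (not_le.mp h)

theorem gap_step_le (hf : ∀ i, ContDiff ℝ 2 (f i)) (hH : HessianBounds (objective f) lam L)
    (hsc : IsSelfConcordant (objective f) 2) {S : State d} (h : Succeeds f lam L S) (y : Vec d) :
    objective f (step f lam L S).w - objective f y
      ≤ gapStep (omega (1 / 6)) (objective f S.w - objective f y) := by
  rw [step_of_succeeds h]
  simp only
  rw [pcgCall_δ hf]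
  refine hH.gap_damped_step_le hsc S.w _ _ y (pcgCall_r hf S.w S.μ) ?_
  rw [← pcgCall_tol hf]
  exact h

variable (what : Fin m → Vec d) (μ₀ : ℝ)

theorem run_succ (n : ℕ) : run f lam L what μ₀ (n + 1) = step f lam L (run f lam L what μ₀ n) :=
  Function.iterate_succ_apply' _ _ _

theorem successCount_zero : successCount f lam L what μ₀ 0 = 0 := Nat.count_zero _

/-- Every call contributes a factor `2`, and a success a further factor `1/4`. -/
theorem run_μ (n : ℕ) :
    (run f lam L what μ₀ n).μ * 4 ^ successCount f lam L what μ₀ n = μ₀ * 2 ^ n := by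
  induction n with
  | zero => simp [run, init, successCount_zero]
  | succ n ih =>
    rw [run_succ, successCount, Nat.count_succ]
    change _ * 4 ^ (successCount f lam L what μ₀ n + _) = _
    by_cases h : Succeeds f lam L (run f lam L what μ₀ n)
    · rw [step_of_succeeds h, if_pos h, pow_succ, pow_succ]
      simp only
      linear_combination 2 * ih
    · rw [step_of_not_succeeds h, if_neg h, pow_succ]
      simp only [add_zero]
      linear_combination 2 * ih

theorem run_μ_pos (hμ₀ : 0 < μ₀) (n : ℕ) : 0 < (run f lam L what μ₀ n).μ := by
  have h := run_μ (f := f) (lam := lam) (L := L) what μ₀ n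
  have h2 : 0 < μ₀ * 2 ^ n := by positivity
  rw [← h] at h2
  exact pos_of_mul_pos_left h2 (by positivity)

theorem step_μ_le_μmax (S : State d) : (step f lam L S).μ ≤ (step f lam L S).μmax := by
  by_cases h : Succeeds f lam L S
  · rw [step_of_succeeds h]; exact le_max_right _ _
  · rw [step_of_not_succeeds h]; exact le_max_right _ _

theorem run_μ_le_μmax (n : ℕ) :
    (run f lam L what μ₀ n).μ ≤ (run f lam L what μ₀ n).μmax := by
  cases n with
  | zero => exact le_rfl
  | succ n => rw [run_succ]; exact step_μ_le_μmax _

theorem μmax_le_step (S : State d) : S.μmax ≤ (step f lam L S).μmax := by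
  by_cases h : Succeeds f lam L S
  · rw [step_of_succeeds h]; exact le_max_left _ _
  · rw [step_of_not_succeeds h]; exact le_max_left _ _

theorem step_rounds (S : State d) :
    (step f lam L S).rounds = S.rounds + (pcgCall f lam L S.w S.μ).rounds := by
  by_cases h : Succeeds f lam L S
  · rw [step_of_succeeds h]
  · rw [step_of_not_succeeds h]

theorem run_rounds_le (hlam : 0 < lam) (hL : lam ≤ L) (hμ₀ : 0 < μ₀) (n : ℕ) :
    ((run f lam L what μ₀ n).rounds : ℝ) ≤ 1 + n * (2
      + √(1 + 2 * (run f lam L what μ₀ n).μmax / lam) * Real.log (2 * L / (beta * lam))) := by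
  have hlog := log_ratio_pos hlam hL
  induction n with
  | zero => simp [run, init]
  | succ n ih =>
    have hmono := μmax_le_step (f := f) (lam := lam) (L := L) (run f lam L what μ₀ n)
    have hle := run_μ_le_μmax (f := f) (lam := lam) (L := L) what μ₀ n
    have hr := pcgCall_rounds_le (f := f) hlam hL (run f lam L what μ₀ n).w
      (run_μ_pos (f := f) (lam := lam) (L := L) what μ₀ hμ₀ n)
    rw [run_succ, step_rounds]
    set S := run f lam L what μ₀ n
    have h1 : √(1 + 2 * S.μmax / lam) * Real.log (2 * L / (beta * lam))
        ≤ √(1 + 2 * (step f lam L S).μmax / lam) * Real.log (2 * L / (beta * lam)) := by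
      gcongr
    have h2 : √(1 + 2 * S.μ / lam) * Real.log (2 * L / (beta * lam))
        ≤ √(1 + 2 * (step f lam L S).μmax / lam) * Real.log (2 * L / (beta * lam)) := by
      gcongr
      exact hle.trans hmono
    have h3 := mul_le_mul_of_nonneg_left h1 (Nat.cast_nonneg (α := ℝ) n)
    push_cast
    linarith

theorem run_gap_le (hf : ∀ i, ContDiff ℝ 2 (f i)) (hH : HessianBounds (objective f) lam L)
    (hsc : IsSelfConcordant (objective f) 2) (y : Vec d) (n : ℕ) :
    objective f (run f lam L what μ₀ n).w - objective f y
      ≤ (gapStep (omega (1 / 6)))^[successCount f lam L what μ₀ n]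
        (objective f (init what μ₀).w - objective f y) := by
  induction n with
  | zero => simp [run, successCount_zero]
  | succ n ih =>
    rw [run_succ, successCount, Nat.count_succ]
    change _ ≤ (gapStep (omega (1 / 6)))^[successCount f lam L what μ₀ n + _] _
    by_cases h : Succeeds f lam L (run f lam L what μ₀ n)
    · rw [if_pos h, Function.iterate_succ_apply']
      exact (gap_step_le hf hH hsc h y).trans (gapStep_mono _ ih)
    · rw [step_of_not_succeeds h, if_neg h]
      exact ih

/-- Under perpetual failure `w` stays fixed while `μ` doubles, until it dominates the Hessian
discrepancy at `w`. -/
theorem exists_succeeds (hf : ∀ i, ContDiff ℝ 2 (f i)) (hH : HessianBounds (objective f) lam L)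
    (hμ₀ : 0 < μ₀) (n : ℕ) : ∃ k, n ≤ k ∧ Succeeds f lam L (run f lam L what μ₀ k) := by
  by_contra! hfail
  have hconst : ∀ j, (run f lam L what μ₀ (n + j)).w = (run f lam L what μ₀ n).w ∧
      (run f lam L what μ₀ (n + j)).μ = (run f lam L what μ₀ n).μ * 2 ^ j := by
    intro j
    induction j with
    | zero => simp
    | succ j ih =>
      rw [← add_assoc, run_succ, step_of_not_succeeds (hfail (n + j) (by omega))]
      exact ⟨ih.1, by rw [ih.2, pow_succ]; ring⟩
  have hμ := run_μ_pos (f := f) (lam := lam) (L := L) what μ₀ hμ₀ n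
  set S := run f lam L what μ₀ n
  obtain ⟨j, hj⟩ := pow_unbounded_of_one_lt (‖hess (f 0) S.w - hess (objective f) S.w‖ / S.μ)
    (one_lt_two (α := ℝ))
  rw [div_lt_iff₀ hμ] at hj
  obtain ⟨hw, hμj⟩ := hconst j
  refine hfail (n + j) (by omega) ?_
  rw [Succeeds, hw, hμj]
  exact norm_pcgCall_r_le_tol hf hH _ (by positivity) (by linarith)

theorem exists_le_successCount (hf : ∀ i, ContDiff ℝ 2 (f i))
    (hH : HessianBounds (objective f) lam L) (hμ₀ : 0 < μ₀) (K : ℕ) :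
    ∃ n, K ≤ successCount f lam L what μ₀ n := by
  induction K with
  | zero => exact ⟨0, Nat.zero_le _⟩
  | succ K ih =>
    obtain ⟨n, hn⟩ := ih
    obtain ⟨k, hk, hs⟩ := exists_succeeds what μ₀ hf hH hμ₀ n
    refine ⟨k + 1, ?_⟩
    have h1 : successCount f lam L what μ₀ n ≤ successCount f lam L what μ₀ k :=
      Nat.count_monotone _ hk
    rw [successCount, Nat.count_succ, if_pos hs]
    exact Nat.succ_le_succ (hn.trans h1)

theorem natCast_le_two_mul_successCount (hμ₀ : 0 < μ₀) (n : ℕ) :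
    (n : ℝ) ≤ 2 * successCount f lam L what μ₀ n
      + Real.logb 2 ((run f lam L what μ₀ n).μmax / μ₀) := by
  have h := run_μ (f := f) (lam := lam) (L := L) what μ₀ n
  have hle := run_μ_le_μmax (f := f) (lam := lam) (L := L) what μ₀ n
  have hpos := run_μ_pos (f := f) (lam := lam) (L := L) what μ₀ hμ₀ n
  set K := successCount f lam L what μ₀ n
  set S := run f lam L what μ₀ n
  have h1 : (n : ℝ) - 2 * K ≤ Real.logb 2 (S.μmax / μ₀) := by
    rw [Real.le_logb_iff_rpow_le one_lt_two (div_pos (hpos.trans_le hle) hμ₀),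
      Real.rpow_sub two_pos, Real.rpow_natCast, Real.rpow_mul two_pos.le, Real.rpow_natCast,
      div_le_div_iff₀ (by positivity) hμ₀]
    norm_num
    nlinarith [mul_le_mul_of_nonneg_right hle (by positivity : (0 : ℝ) ≤ 4 ^ K)]
  linarith

end Run

end DiSCO

end

theorem theorem4 {m d : ℕ} [NeZero m] (f : Fin m → DiSCO.Vec d → ℝ)
    (hf : ∀ i, ContDiff ℝ 2 (f i)) (lam L : ℝ)
    (hH : DiSCO.HessianBounds (DiSCO.objective f) lam L)
    (hsc : DiSCO.IsSelfConcordant (DiSCO.objective f) 2)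
    (wstar : DiSCO.Vec d) (hstar : IsMinOn (DiSCO.objective f) Set.univ wstar)
    (ρ : ℝ) (hρ : 0 ≤ ρ) (what : Fin m → DiSCO.Vec d)
    (hwhat : ∀ i, IsMinOn (fun w => f i w + ρ / 2 * ‖w‖ ^ 2) Set.univ (what i))
    (μ₀ : ℝ) (hμ₀ : 0 < μ₀) (ε : ℝ) (hε : 0 < ε) :
    ∃ n : ℕ,
      DiSCO.objective f (DiSCO.run f lam L what μ₀ n).w - DiSCO.objective f wstar < ε ∧
      (∀ j < n, ε ≤ DiSCO.objective f (DiSCO.run f lam L what μ₀ j).w -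
        DiSCO.objective f wstar) ∧
      ((DiSCO.run f lam L what μ₀ n).rounds : ℝ) ≤
        1 + (2 * (⌈(DiSCO.objective f (DiSCO.init what μ₀).w - DiSCO.objective f wstar) /
                  DiSCO.omega (1 / 6)⌉₊ : ℝ)
              + 2 * (⌈Real.logb 2 (2 * DiSCO.omega (1 / 6) / ε)⌉₊ : ℝ)
              + Real.logb 2 ((DiSCO.run f lam L what μ₀ n).μmax / μ₀))
            * (2 + Real.sqrt (1 + 2 * (DiSCO.run f lam L what μ₀ n).μmax / lam)
                * Real.log (2 * L / (DiSCO.beta * lam))) := by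
  classical
  have hω : 0 < DiSCO.omega (1 / 6) := DiSCO.omega_pos (by norm_num)
  set K := ⌈(DiSCO.objective f (DiSCO.init what μ₀).w - DiSCO.objective f wstar) /
    DiSCO.omega (1 / 6)⌉₊ + ⌈Real.logb 2 (2 * DiSCO.omega (1 / 6) / ε)⌉₊ with hK
  have hsmall : ∀ n, K ≤ DiSCO.successCount f lam L what μ₀ n →
      DiSCO.objective f (DiSCO.run f lam L what μ₀ n).w - DiSCO.objective f wstar < ε :=
    fun n hn => (DiSCO.run_gap_le what μ₀ hf hH hsc wstar n).trans_lt
      (DiSCO.gapStep_iterate_lt hω _ hε _ hn)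
  have hex : ∃ n, DiSCO.objective f (DiSCO.run f lam L what μ₀ n).w
      - DiSCO.objective f wstar < ε := by
    obtain ⟨n, hn⟩ := DiSCO.exists_le_successCount what μ₀ hf hH hμ₀ K
    exact ⟨n, hsmall n hn⟩
  have hmin : ∀ j < Nat.find hex, ε ≤ DiSCO.objective f (DiSCO.run f lam L what μ₀ j).w -
      DiSCO.objective f wstar := fun j hj => not_lt.mp (Nat.find_min hex hj)
  refine ⟨Nat.find hex, Nat.find_spec hex, hmin, ?_⟩
  set n := Nat.find hex
  -- Before the last call the gap is still at least `ε`, so fewer than `K` successes have occurred;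
  -- the last call adds at most one.
  have hcount : DiSCO.successCount f lam L what μ₀ n ≤ K := by
    rcases Nat.eq_zero_or_pos n with h0 | hpos
    · rw [h0, DiSCO.successCount_zero]; exact Nat.zero_le _
    · obtain ⟨k, hk⟩ := Nat.exists_eq_add_of_le' hpos
      have h1 : DiSCO.successCount f lam L what μ₀ k < K := by
        by_contra! h
        exact absurd (hsmall k h) (not_lt.mpr (hmin k (by omega)))
      rw [hk, DiSCO.successCount, Nat.count_succ]
      change DiSCO.successCount f lam L what μ₀ k + _ ≤ K
      split_ifs <;> omega
  have hn := DiSCO.natCast_le_two_mul_successCount (f := f) (lam := lam) (L := L) what μ₀ hμ₀ n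
  have hlog := DiSCO.log_ratio_pos hH.lam_pos hH.lam_le
  refine (DiSCO.run_rounds_le (f := f) what μ₀ hH.lam_pos hH.lam_le hμ₀ n).trans ?_
  have hcount' : (DiSCO.successCount f lam L what μ₀ n : ℝ) ≤ K := by exact_mod_cast hcount
  rw [hK] at hcount'
  push_cast at hcount'
  gcongr
  linarith
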